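/- Let $n\in\mathbb N$. A problem $L(Q,A,h)$ consists of a matrix function $Q\in L^1((0,\infty),\mathbb C^{n\times n})$ (not necessarily Hermitian), an orthogonal projection matrix $A\in\mathbb C^{n\times n}$ (that is, $A^\dagger=A=A^2$; put $A^\perp=I-A$), and a matrix $h\in\mathbb C^{n\times n}$ (not necessarily Hermitian) with $h=AhA$. It stands for the equation $-Y''+Q(x)Y=\lambda Y$, $x>0$, with the boundary condition $T(Y):=A(Y'(0)-hY(0))-A^\perp Y(0)=0$. Let $\lambda=\rho^2$ and $\Omega=\{\rho\in\mathbb C:\operatorname{Im}\rho\ge 0,\ \rho\ne 0\}$. For $\rho\in\Omega$ let $e(x,\rho)$ be the Jost solution, that is, the unique continuous matrix function on $[0,\infty)$ with $e(x,\rho)=O(e^{i\rho x})$ and $$e(x,\rho)=e^{i\rho x}I+\int_x^\infty\frac{\sin\rho(t-x)}{\rho}\,Q(t)\,e(t,\rho)\,dt,\qquad x\ge 0.$$ Let $J(\rho)=T(e(\cdot,\rho))$. For those $\rho\in\Omega$ with $\det J(\rho)\neq 0$ let $\phi(x,\lambda)=e(x,\rho)J(\rho)^{-1}$ be the Weyl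 solution and $M(\lambda)=A\,\phi(0,\lambda)+A^\perp\phi'(0,\lambda)$ the Weyl matrix. Here $\lambda=\rho^2$, $\rho\in\Omega$, ranges over the plane cut along $[0,\infty)$, both sides of the cut included and $0$ removed. **Theorem.** Let $L(Q,A,h)$ and $L(\widetilde Q,\widetilde A,\widetilde h)$ be two such problems of the same size $n$, with Weyl matrices $M$ and $\widetilde M$. If $M(\lambda)=\widetilde M(\lambda)$ for all $\lambda=\rho^2$, $\rho\in\Omega$, at which both are defined, then $Q=\widetilde Q$ almost everywhere on $(0,\infty)$, $h=\widetilde h$ and $A=\widetilde A$. Moreover, for every problem $L(Q,A,h)$, $$A=I-\lim_{|\rho|\to\infty,\ \rho\in\Omega}\frac{M(\rho^2)}{-i\rho}.$$ -/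

import Mathlib

open Set Filter Topology MeasureTheory
-- Matrices carry the operator norm. Integrability and boundedness do not depend on the choice of
-- the norm, since all norms on a finite-dimensional space are equivalent.
open scoped Matrix.Norms.L2Operator

noncomputable section

namespace MatrixSchrodinger

variable {n : ℕ}

/-- The closed upper half-plane without the origin. The map `ρ ↦ λ = ρ ^ 2` identifies it with the
`λ`-plane cut along `[0, ∞)`, both sides of the cut included and the point `0` removed. -/
def Omega : Set ℂ := {ρ | 0 ≤ ρ.im ∧ ρ ≠ 0}

/-- `e` is the Jost solution of `-Y'' + Q Y = ρ ^ 2 Y` on the half-line: a continuous solution on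
`[0, ∞)` of `e(x) = exp(iρx) I + ∫_x^∞ ρ⁻¹ sin(ρ(t - x)) Q(t) e(t) dt` which is
`O(exp(iρx))`, so that for integrable `Q` the integral converges absolutely. -/
structure IsJostSolution (Q : ℝ → Matrix (Fin n) (Fin n) ℂ) (ρ : ℂ)
    (e : ℝ → Matrix (Fin n) (Fin n) ℂ) : Prop where
  continuousOn : ContinuousOn e (Ici 0)
  bounded : ∃ C : ℝ, ∀ x : ℝ, 0 ≤ x → ‖e x‖ ≤ C * ‖Complex.exp (Complex.I * ρ * x)‖
  integral_eq : ∀ x : ℝ, 0 ≤ x →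
    e x = Complex.exp (Complex.I * ρ * x) • (1 : Matrix (Fin n) (Fin n) ℂ) +
      ∫ t in Ioi x, (Complex.sin (ρ * (t - x)) / ρ) • (Q t * e t)

/-- The Jost solution `x ↦ e(x, ρ)`; only its values on `[0, ∞)` are meaningful, and there it is
unique when `Q` is integrable and `ρ ∈ Omega`. -/
def jostSolution (Q : ℝ → Matrix (Fin n) (Fin n) ℂ) (ρ : ℂ) : ℝ → Matrix (Fin n) (Fin n) ℂ :=
  Classical.epsilon (IsJostSolution Q ρ)

/-- The (one-sided) derivative at `0` of a function on `[0, ∞)`. -/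
def derivAtZero (Y : ℝ → Matrix (Fin n) (Fin n) ℂ) : Matrix (Fin n) (Fin n) ℂ :=
  derivWithin Y (Ici 0) 0

/-- The boundary form `T(Y) = A (Y'(0) - h Y(0)) - A^⊥ Y(0)`, where `A^⊥ = I - A`. -/
def boundaryForm (A h : Matrix (Fin n) (Fin n) ℂ) (Y : ℝ → Matrix (Fin n) (Fin n) ℂ) :
    Matrix (Fin n) (Fin n) ℂ :=
  A * (derivAtZero Y - h * Y 0) - (1 - A) * Y 0

/-- The Jost matrix `J(ρ) = T(e(·, ρ))`. -/
def jostMatrix (Q : ℝ → Matrix (Fin n) (Fin n) ℂ) (A h : Matrix (Fin n) (Fin n) ℂ) (ρ : ℂ) :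
    Matrix (Fin n) (Fin n) ℂ :=
  boundaryForm A h (jostSolution Q ρ)

/-- The Weyl solution `φ(x, λ) = e(x, ρ) J(ρ)⁻¹`, `λ = ρ ^ 2`, meaningful when
`det J(ρ) ≠ 0`. -/
def weylSolution (Q : ℝ → Matrix (Fin n) (Fin n) ℂ) (A h : Matrix (Fin n) (Fin n) ℂ) (ρ : ℂ) :
    ℝ → Matrix (Fin n) (Fin n) ℂ :=
  fun x => jostSolution Q ρ x * (jostMatrix Q A h ρ)⁻¹

/-- The Weyl matrix `M(λ) = A φ(0, λ) + A^⊥ φ'(0, λ)` as a function of `ρ`, `λ = ρ ^ 2`. -/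
def weylMatrix (Q : ℝ → Matrix (Fin n) (Fin n) ℂ) (A h : Matrix (Fin n) (Fin n) ℂ) (ρ : ℂ) :
    Matrix (Fin n) (Fin n) ℂ :=
  A * weylSolution Q A h ρ 0 + (1 - A) * derivAtZero (weylSolution Q A h ρ)

/-- The points `ρ` of `Omega` at which the Weyl matrix is defined: those with `det J(ρ) ≠ 0`. -/
def weylDomain (Q : ℝ → Matrix (Fin n) (Fin n) ℂ) (A h : Matrix (Fin n) (Fin n) ℂ) : Set ℂ :=
  {ρ | ρ ∈ Omega ∧ (jostMatrix Q A h ρ).det ≠ 0}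

/-- The coefficients of a problem `L(Q, A, h)`: `Q ∈ L¹(0, ∞)`, `A` is an orthogonal projection
(`A^† = A = A ^ 2`), and `h = A h A`. Neither `Q` nor `h` has to be Hermitian. -/
structure IsProblem (Q : ℝ → Matrix (Fin n) (Fin n) ℂ) (A h : Matrix (Fin n) (Fin n) ℂ) :
    Prop where
  integrable : IntegrableOn Q (Ioi 0)
  projection : IsStarProjection A
  compressed : h = A * h * A

end MatrixSchrodinger

end

set_option linter.unusedSectionVars false

/-! The argument is the method of spectral mappings, run at one fixed point `X` at a time and for
large `ρ` only. Write `A^⊥ = 1 - A` and `D = ρ⁻¹ A + A^⊥`.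

Once `|ρ|` is at least twice the `L¹` norm of `Q`, the integral equations contract by a factor
`1/2`. This yields `e = exp(iρx)(1 + O(1/ρ))` and `e' = iρ exp(iρx)(1 + O(1/ρ))`. After its `A`-part
is divided by `ρ`, the boundary form of `e` tends to `iA - A^⊥`, whose inverse is `-iA - A^⊥`. Hence
`J⁻¹ = N D` with `N → -iA - A^⊥`, so that `M / (-iρ) → A^⊥` (`IsJostFamily.tendsto_weyl`). This is
the limit formula, and it shows that `M` determines `A`.

With `A` common to both problems, the Weyl solution is `φ = C + S M`, where `C` and `S` have initial
values independent of `λ` and are entire in `λ` at `X` (`exists_entire_isSol`). The inverse of the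
fundamental matrix of the second problem is read off from solutions `C*`, `S*` of its transpose,
because the mixed Wronskian is constant. This gives entire functions `P₁ = S C*' - C S*'` and `P₂ =
C S* - S C*` with `φ = P₁ φ̃ + P₂ φ̃'`. The transposed problem has the same Weyl matrix
(`IsJost.weyl_op_eq`). As the two Weyl matrices coincide, the terms with `M` cancel, and `C`, `C*`
may be replaced by the decaying Weyl solutions. The growth of `S` then meets the decay of `φ`, and
the powers of `ρ` balance through `D`: `P₁` is bounded and `P₂ = O(1/ρ)`. By Liouville, `P₂ = 0` and
`P₁` is constant; leading terms along the imaginary axis give `P₁ = 1`. So `φ = φ̃`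
(`weylFamily_eq`). Since `φ` is invertible for large `ρ`, the equation returns `Q` and the initial
values return `h` (`eq_of_weylM_eq`).

The analysis takes place in a complex Banach algebra, so that the transposed problem is the same
theory over the opposite algebra. -/

namespace MatrixSchrodinger

/-! ### Calculus of absolutely continuous functions with values in a Banach space -/

section Primitive

variable {E F G : Type*} [NormedAddCommGroup E] [NormedSpace ℝ E] [CompleteSpace E]
  [NormedAddCommGroup F] [NormedSpace ℝ F] [CompleteSpace F]
  [NormedAddCommGroup G] [NormedSpace ℝ G] [CompleteSpace G]

/-- On `[0, X]`, the function `u` is an absolutely continuous primitive of `v ∈ L¹(0, X)`. -/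
structure IsPrimitive (u v : ℝ → E) (X : ℝ) : Prop where
  integrable : IntervalIntegrable v volume 0 X
  eq : ∀ x ∈ Icc 0 X, u x = u 0 + ∫ t in (0)..x, v t

/-- The increments of `u` are dominated by those of the primitive of `k`, which is absolutely
continuous. -/
theorem absolutelyContinuousOnInterval_of_norm_sub_le {u : ℝ → E} {k : ℝ → ℝ} {a b : ℝ}
    (hk : IntervalIntegrable k volume a b)
    (h : ∀ x ∈ Icc a b, ∀ y ∈ Icc a b, x ≤ y → ‖u y - u x‖ ≤ ∫ t in x..y, k t) (hab : a ≤ b) :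
    AbsolutelyContinuousOnInterval u a b := by
  have hac := hk.absolutelyContinuousOnInterval_intervalIntegral (c := a) (by simp)
  have hd : ∀ x ∈ Icc a b, ∀ y ∈ Icc a b,
      dist (u x) (u y) ≤ dist (∫ t in a..x, k t) (∫ t in a..y, k t) := by
    have key : ∀ x ∈ Icc a b, ∀ y ∈ Icc a b, x ≤ y →
        dist (u x) (u y) ≤ dist (∫ t in a..x, k t) (∫ t in a..y, k t) := by
      intro x hx y hy hxy
      rw [dist_comm, dist_eq_norm, dist_comm, dist_eq_norm,
        intervalIntegral.integral_interval_sub_left]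
      · exact (h x hx y hy hxy).trans (le_abs_self _)
      · exact hk.mono_set (by rw [uIcc_of_le hab, uIcc_of_le hy.1]; exact Icc_subset_Icc_right hy.2)
      · exact hk.mono_set (by rw [uIcc_of_le hab, uIcc_of_le hx.1]; exact Icc_subset_Icc_right hx.2)
    intro x hx y hy
    rcases le_total x y with hxy | hxy
    · exact key x hx y hy hxy
    · rw [dist_comm, dist_comm (∫ t in a..x, k t)]; exact key y hy x hx hxy
  unfold AbsolutelyContinuousOnInterval at hac ⊢
  refine squeeze_zero' (Eventually.of_forall fun _ => Finset.sum_nonneg fun _ _ => dist_nonneg) ?_ hac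
  rw [eventually_inf_principal]
  filter_upwards with ⟨m, I⟩ hI
  refine Finset.sum_le_sum fun i hi => ?_
  have := hI.1 i hi
  rw [uIcc_of_le hab] at this
  exact hd _ this.1 _ this.2

namespace IsPrimitive

variable {u v : ℝ → E} {X : ℝ}

theorem intervalIntegrable (h : IsPrimitive u v X) {x y : ℝ} (hx : x ∈ Icc 0 X)
    (hy : y ∈ Icc 0 X) : IntervalIntegrable v volume x y :=
  h.integrable.mono_set (by
    rw [uIcc_of_le (hx.1.trans hx.2)]
    exact uIcc_subset_Icc hx hy)

theorem sub_eq (h : IsPrimitive u v X) {x y : ℝ} (hx : x ∈ Icc 0 X) (hy : y ∈ Icc 0 X) :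
    u y - u x = ∫ t in x..y, v t := by
  have h0 : (0 : ℝ) ∈ Icc 0 X := ⟨le_rfl, hx.1.trans hx.2⟩
  rw [h.eq x hx, h.eq y hy, add_sub_add_left_eq_sub, intervalIntegral.integral_interval_sub_left
    (h.intervalIntegrable h0 hy) (h.intervalIntegrable h0 hx)]

theorem continuousOn (h : IsPrimitive u v X) : ContinuousOn u (Icc 0 X) := by
  rcases lt_or_ge X 0 with hX | hX
  · simp [Icc_eq_empty hX.not_ge]
  have := intervalIntegral.continuousOn_primitive_interval' h.integrable (a := 0) (by simp)
  rw [uIcc_of_le hX] at this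
  exact (continuousOn_const.add this).congr h.eq

theorem ae_hasDerivAt (h : IsPrimitive u v X) (hX : 0 ≤ X) :
    ∀ᵐ x, x ∈ Ioo 0 X → HasDerivAt u (v x) x := by
  filter_upwards [h.integrable.ae_hasDerivAt_integral] with x hx hx'
  rw [uIcc_of_le hX] at hx
  have := (hx (Ioo_subset_Icc_self hx') 0 ⟨le_rfl, hX⟩).const_add (u 0)
  refine this.congr_of_eventuallyEq ?_
  filter_upwards [Ioo_mem_nhds hx'.1 hx'.2] with y hy
  exact h.eq y (Ioo_subset_Icc_self hy)

theorem add {u' v' : ℝ → E} (h : IsPrimitive u v X) (h' : IsPrimitive u' v' X) :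
    IsPrimitive (fun x => u x + u' x) (fun x => v x + v' x) X := by
  refine ⟨h.integrable.add h'.integrable, fun x hx => ?_⟩
  have h0 : (0 : ℝ) ∈ Icc 0 X := ⟨le_rfl, hx.1.trans hx.2⟩
  rw [intervalIntegral.integral_add (h.intervalIntegrable h0 hx) (h'.intervalIntegrable h0 hx),
    h.eq x hx, h'.eq x hx]
  abel

theorem clm (h : IsPrimitive u v X) (T : E →L[ℝ] F) :
    IsPrimitive (fun x => T (u x)) (fun x => T (v x)) X := by
  refine ⟨⟨T.integrable_comp h.integrable.1, T.integrable_comp h.integrable.2⟩, fun x hx => ?_⟩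
  have h0 : (0 : ℝ) ∈ Icc 0 X := ⟨le_rfl, hx.1.trans hx.2⟩
  rw [T.intervalIntegral_comp_comm (h.intervalIntegrable h0 hx), h.eq x hx, map_add]

theorem sub {u' v' : ℝ → E} (h : IsPrimitive u v X) (h' : IsPrimitive u' v' X) :
    IsPrimitive (fun x => u x - u' x) (fun x => v x - v' x) X := by
  simpa [sub_eq_add_neg] using h.add (h'.clm (-ContinuousLinearMap.id ℝ E))

theorem of_hasDerivAt (h : ∀ x, HasDerivAt u (v x) x) (hv : Continuous v) :
    IsPrimitive u v X := by
  refine ⟨hv.intervalIntegrable _ _, fun x _ => ?_⟩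
  rw [intervalIntegral.integral_eq_sub_of_hasDerivAt (fun y _ => h y) (hv.intervalIntegrable _ _)]
  abel

theorem congr {u' v' : ℝ → E} (h : IsPrimitive u v X) (hX : 0 ≤ X) (hu : EqOn u' u (Icc 0 X))
    (hv : EqOn v' v (Ioc 0 X)) : IsPrimitive u' v' X := by
  refine ⟨h.integrable.congr (by rw [uIoc_of_le hX]; exact fun x hx => (hv hx).symm),
    fun x hx => ?_⟩
  rw [hu hx, hu ⟨le_rfl, hX⟩, h.eq x hx]
  congr 1
  refine intervalIntegral.integral_congr_ae (Eventually.of_forall fun t ht => ?_)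
  rw [uIoc_of_le hx.1] at ht
  exact (hv ⟨ht.1, ht.2.trans hx.2⟩).symm

/-- The product rule for a continuous bilinear product of absolutely continuous functions. -/
theorem bilin {u' v' : ℝ → F} (h : IsPrimitive u v X) (h' : IsPrimitive u' v' X)
    (B : E →L[ℝ] F →L[ℝ] G) (hX : 0 ≤ X) :
    IsPrimitive (fun x => B (u x) (u' x)) (fun x => B (v x) (u' x) + B (u x) (v' x)) X := by
  obtain ⟨C, hC⟩ := isCompact_Icc.exists_bound_of_continuousOn h.continuousOn
  obtain ⟨C', hC'⟩ := isCompact_Icc.exists_bound_of_continuousOn h'.continuousOn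
  have hint : IntervalIntegrable (fun x => B (v x) (u' x) + B (u x) (v' x)) volume 0 X := by
    rw [intervalIntegrable_iff_integrableOn_Ioc_of_le hX]
    have hv := (intervalIntegrable_iff_integrableOn_Ioc_of_le hX).1 h.integrable
    have hv' := (intervalIntegrable_iff_integrableOn_Ioc_of_le hX).1 h'.integrable
    have hu : AEStronglyMeasurable u (volume.restrict (Ioc 0 X)) :=
      (h.continuousOn.mono Ioc_subset_Icc_self).aestronglyMeasurable measurableSet_Ioc
    have hu' : AEStronglyMeasurable u' (volume.restrict (Ioc 0 X)) :=
      (h'.continuousOn.mono Ioc_subset_Icc_self).aestronglyMeasurable measurableSet_Ioc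
    refine Integrable.add ?_ ?_
    · refine Integrable.mono' (hv.norm.const_mul (‖B‖ * C'))
        (B.aestronglyMeasurable_comp₂ hv.aestronglyMeasurable hu') ?_
      filter_upwards [ae_restrict_mem measurableSet_Ioc] with t ht
      calc ‖B (v t) (u' t)‖ ≤ ‖B‖ * ‖v t‖ * ‖u' t‖ := B.le_opNorm₂ _ _
        _ ≤ ‖B‖ * ‖v t‖ * C' := by gcongr; exact hC' t (Ioc_subset_Icc_self ht)
        _ = _ := by ring
    · refine Integrable.mono' (hv'.norm.const_mul (‖B‖ * C))
        (B.aestronglyMeasurable_comp₂ hu hv'.aestronglyMeasurable) ?_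
      filter_upwards [ae_restrict_mem measurableSet_Ioc] with t ht
      calc ‖B (u t) (v' t)‖ ≤ ‖B‖ * ‖u t‖ * ‖v' t‖ := B.le_opNorm₂ _ _
        _ ≤ ‖B‖ * C * ‖v' t‖ := by gcongr; exact hC t (Ioc_subset_Icc_self ht)
        _ = _ := by ring
  refine ⟨hint, ?_⟩
  set w := fun x => B (v x) (u' x) + B (u x) (v' x)
  -- The defect `H` of the product formula is absolutely continuous and has derivative zero almost
  -- everywhere, so it is constant.
  set H : ℝ → G := fun x => B (u x) (u' x) - ∫ t in (0)..x, w t with hH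
  have hII : ∀ {x y : ℝ}, x ∈ Icc 0 X → y ∈ Icc 0 X → IntervalIntegrable w volume x y := by
    intro x y hx hy
    exact hint.mono_set (by rw [uIcc_of_le hX]; exact uIcc_subset_Icc hx hy)
  have h0 : (0 : ℝ) ∈ Icc 0 X := ⟨le_rfl, hX⟩
  have hac : AbsolutelyContinuousOnInterval H 0 X := by
    refine absolutelyContinuousOnInterval_of_norm_sub_le
      (k := fun t => ‖B‖ * C' * ‖v t‖ + ‖B‖ * C * ‖v' t‖ + ‖w t‖)
      (((h.integrable.norm.const_mul _).add (h'.integrable.norm.const_mul _)).add hint.norm)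
      ?_ hX
    intro x hx y hy hxy
    have i1 := (h.intervalIntegrable hx hy).norm
    have i2 := (h'.intervalIntegrable hx hy).norm
    rw [intervalIntegral.integral_add ((i1.const_mul _).add (i2.const_mul _)) (hII hx hy).norm,
      intervalIntegral.integral_add (i1.const_mul _) (i2.const_mul _),
      intervalIntegral.integral_const_mul, intervalIntegral.integral_const_mul]
    have e1 : H y - H x = B (u y - u x) (u' y) + B (u x) (u' y - u' x) - ∫ t in x..y, w t := by
      rw [← intervalIntegral.integral_interval_sub_left (hII h0 hy) (hII h0 hx)]
      simp only [hH, map_sub, sub_apply]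
      abel
    have b1 : ‖u y - u x‖ ≤ ∫ t in x..y, ‖v t‖ := by
      rw [h.sub_eq hx hy]; exact intervalIntegral.norm_integral_le_integral_norm hxy
    have b2 : ‖u' y - u' x‖ ≤ ∫ t in x..y, ‖v' t‖ := by
      rw [h'.sub_eq hx hy]; exact intervalIntegral.norm_integral_le_integral_norm hxy
    have hC0 : 0 ≤ C := (norm_nonneg _).trans (hC x hx)
    rw [e1]
    refine (norm_sub_le _ _).trans (add_le_add ((norm_add_le _ _).trans (add_le_add ?_ ?_))
      (intervalIntegral.norm_integral_le_integral_norm hxy))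
    · calc _ ≤ ‖B‖ * ‖u y - u x‖ * ‖u' y‖ := B.le_opNorm₂ _ _
        _ ≤ ‖B‖ * (∫ t in x..y, ‖v t‖) * C' := by
          have b0 := (norm_nonneg _).trans b1
          exact mul_le_mul (by gcongr) (hC' y hy) (norm_nonneg _) (by positivity)
        _ = _ := by ring
    · calc _ ≤ ‖B‖ * ‖u x‖ * ‖u' y - u' x‖ := B.le_opNorm₂ _ _
        _ ≤ ‖B‖ * C * (∫ t in x..y, ‖v' t‖) := by gcongr; exact hC x hx
  have hd : ∀ᵐ x, x ∈ uIcc 0 X → HasDerivAt H 0 x := by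
    have n0 : ∀ᵐ x : ℝ, x ≠ 0 := by simp [ae_iff, measure_singleton]
    have nX : ∀ᵐ x : ℝ, x ≠ X := by simp [ae_iff, measure_singleton]
    filter_upwards [h.ae_hasDerivAt hX, h'.ae_hasDerivAt hX, hint.ae_hasDerivAt_integral, n0, nX]
      with x d1 d2 d3 hx0 hxX hx
    have d3' := d3 hx 0 (by simp)
    rw [uIcc_of_le hX] at hx
    have hx' : x ∈ Ioo 0 X := ⟨lt_of_le_of_ne hx.1 (Ne.symm hx0), lt_of_le_of_ne hx.2 hxX⟩
    have := (B.hasFDerivAt_of_bilinear (d1 hx').hasFDerivAt (d2 hx').hasFDerivAt).hasDerivAt.sub d3'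
    convert! this using 1
    simp [w, add_comm]
  obtain ⟨c, hc⟩ := hac.const_of_ae_hasDerivAt_zero hd
  intro x hx
  rw [uIcc_of_le hX] at hc
  have e := (hc x hx).trans (hc 0 h0).symm
  simp only [hH, intervalIntegral.integral_same, sub_zero] at e
  rw [← e]; abel

/-- Links the almost-everywhere derivative with the one-sided derivative at `0` that enters the
boundary condition. -/
theorem hasDerivWithinAt_zero (h : IsPrimitive u v X) (hX : 0 < X)
    (hv : ContinuousOn v (Icc 0 X)) : HasDerivWithinAt u (v 0) (Ici 0) 0 := by
  have hm : Icc (0 : ℝ) X ∈ 𝓝[Ici 0] 0 := Icc_mem_nhdsGE hX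
  have hc : ContinuousWithinAt v (Ici 0) 0 :=
    (hv 0 ⟨le_rfl, hX.le⟩).mono_of_mem_nhdsWithin hm
  have hsm : StronglyMeasurableAtFilter v (𝓝[Ioi 0] 0) :=
    ⟨Icc 0 X, nhdsWithin_mono _ Ioi_subset_Ici_self hm, hv.aestronglyMeasurable measurableSet_Icc⟩
  have hd : HasDerivWithinAt (fun x => u 0 + ∫ t in (0)..x, v t) (v 0) (Ici 0) 0 :=
    (intervalIntegral.integral_hasDerivWithinAt_right (a := 0) (b := 0) (s := Ici 0) (t := Ioi 0)
      (by simp) hsm (hc.mono Ioi_subset_Ici_self)).const_add _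
  exact hd.congr_of_eventuallyEq (by filter_upwards [hm] with x hx using h.eq x hx) (by simp)

end IsPrimitive

end Primitive

/-! ### Bounds for sine and cosine in the complex plane -/

theorem norm_sin_le_exp (z : ℂ) {r : ℝ} (h : |z.im| ≤ r) : ‖Complex.sin z‖ ≤ Real.exp r := by
  have h1 : ‖Complex.exp (-z * Complex.I)‖ ≤ Real.exp r := by
    rw [Complex.norm_exp]; apply Real.exp_le_exp.2; simpa using (le_abs_self _).trans h
  have h2 : ‖Complex.exp (z * Complex.I)‖ ≤ Real.exp r := by
    rw [Complex.norm_exp]; apply Real.exp_le_exp.2; simpa using (neg_le_abs _).trans h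
  have := norm_sub_le (Complex.exp (-z * Complex.I)) (Complex.exp (z * Complex.I))
  rw [Complex.sin, norm_div, norm_mul, Complex.norm_I, Complex.norm_ofNat]
  linarith

theorem norm_cos_le_exp (z : ℂ) {r : ℝ} (h : |z.im| ≤ r) : ‖Complex.cos z‖ ≤ Real.exp r := by
  have h1 : ‖Complex.exp (-z * Complex.I)‖ ≤ Real.exp r := by
    rw [Complex.norm_exp]; apply Real.exp_le_exp.2; simpa using (le_abs_self _).trans h
  have h2 : ‖Complex.exp (z * Complex.I)‖ ≤ Real.exp r := by
    rw [Complex.norm_exp]; apply Real.exp_le_exp.2; simpa using (neg_le_abs _).trans h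
  have := norm_add_le (Complex.exp (z * Complex.I)) (Complex.exp (-z * Complex.I))
  rw [Complex.cos, norm_div, Complex.norm_ofNat]
  linarith

/-! ### Solutions on a finite interval: Wronskian, variation of constants, growth in `ρ` -/

section Algebra

variable {𝔸 : Type*} [NormedRing 𝔸] [NormedAlgebra ℂ 𝔸] [CompleteSpace 𝔸]

/-- `Y` is a solution of `-Y'' + q Y = μ Y` on `[0, X]` with the derivative `Z`. -/
structure IsSol (q : ℝ → 𝔸) (μ : ℂ) (X : ℝ) (Y Z : ℝ → 𝔸) : Prop where
  prim : IsPrimitive Y Z X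
  prim' : IsPrimitive Z (fun t => q t * Y t - μ • Y t) X

namespace IsSol

variable {q : ℝ → 𝔸} {μ : ℂ} {X : ℝ} {Y Z Y' Z' : ℝ → 𝔸}

theorem add (h : IsSol q μ X Y Z) (h' : IsSol q μ X Y' Z') :
    IsSol q μ X (fun x => Y x + Y' x) (fun x => Z x + Z' x) := by
  refine ⟨h.prim.add h'.prim, ?_⟩
  convert! h.prim'.add h'.prim' using 2
  rw [mul_add, smul_add]; abel

theorem sub (h : IsSol q μ X Y Z) (h' : IsSol q μ X Y' Z') :
    IsSol q μ X (fun x => Y x - Y' x) (fun x => Z x - Z' x) := by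
  refine ⟨h.prim.sub h'.prim, ?_⟩
  convert! h.prim'.sub h'.prim' using 2
  rw [mul_sub, smul_sub]; abel

theorem mul_const (h : IsSol q μ X Y Z) (a : 𝔸) :
    IsSol q μ X (fun x => Y x * a) (fun x => Z x * a) := by
  refine ⟨h.prim.clm ((ContinuousLinearMap.mul ℝ 𝔸).flip a), ?_⟩
  convert! h.prim'.clm ((ContinuousLinearMap.mul ℝ 𝔸).flip a) using 2
  simp [mul_assoc]

/-- Over the opposite algebra the coefficient multiplies from the right after `unop`. In the
derivative of `Zo Y - Yo Z` the two terms `Yo q Y` cancel, and so do the terms in `μ` and in `Zo Z`.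
-/
theorem wronskian {Yo Zo : ℝ → 𝔸ᵐᵒᵖ} (h : IsSol q μ X Y Z)
    (ho : IsSol (fun t => MulOpposite.op (q t)) μ X Yo Zo) {x : ℝ} (hx : x ∈ Icc 0 X) :
    (Zo x).unop * Y x - (Yo x).unop * Z x = (Zo 0).unop * Y 0 - (Yo 0).unop * Z 0 := by
  have hX : 0 ≤ X := hx.1.trans hx.2
  have p := ho.prim.clm
    ((MulOpposite.opContinuousLinearEquiv ℝ).symm : 𝔸ᵐᵒᵖ ≃L[ℝ] 𝔸).toContinuousLinearMap
  have p' := ho.prim'.clm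
    ((MulOpposite.opContinuousLinearEquiv ℝ).symm : 𝔸ᵐᵒᵖ ≃L[ℝ] 𝔸).toContinuousLinearMap
  have w := (p'.bilin h.prim (ContinuousLinearMap.mul ℝ 𝔸) hX).sub
    (p.bilin h.prim' (ContinuousLinearMap.mul ℝ 𝔸) hX)
  have e := w.eq x hx
  simp only [ContinuousLinearMap.mul_apply', ContinuousLinearEquiv.coe_coe,
    MulOpposite.opContinuousLinearEquiv_symm_apply, MulOpposite.unop_sub, MulOpposite.unop_mul,
    MulOpposite.unop_op, MulOpposite.unop_smul, sub_mul, mul_sub, mul_assoc, smul_mul_assoc,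
    mul_smul_comm] at e
  rw [e, intervalIntegral.integral_congr (g := fun _ => (0 : 𝔸)) fun t _ => by dsimp only; abel]
  simp

/-- The conditions on `c` and `d` remove everything but `d q Y` from the derivative of `c Y + d Z`.
Pairs that take the values `(1, 0)` or `(0, 1)` at the endpoint `x` give the variation-of-constants
formulas for `Y` and `Z`. -/
theorem smul_cos_add (h : IsSol q μ X Y Z) {c d c' d' : ℝ → ℂ} {x : ℝ}
    (hc : ∀ t, HasDerivAt c (c' t) t) (hd : ∀ t, HasDerivAt d (d' t) t)
    (hcc : Continuous c') (hdc : Continuous d')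
    (e1 : ∀ t, c t + d' t = 0) (e2 : ∀ t, c' t = μ * d t) (hx : x ∈ Icc 0 X) :
    c x • Y x + d x • Z x = c 0 • Y 0 + d 0 • Z 0 + ∫ t in (0)..x, d t • (q t * Y t) := by
  have hX : 0 ≤ X := hx.1.trans hx.2
  have w := ((IsPrimitive.of_hasDerivAt hc hcc (X := X)).bilin h.prim
      (ContinuousLinearMap.lsmul ℝ ℂ) hX).add
    ((IsPrimitive.of_hasDerivAt hd hdc (X := X)).bilin h.prim' (ContinuousLinearMap.lsmul ℝ ℂ) hX)
  have e := w.eq x hx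
  simp only [ContinuousLinearMap.lsmul_apply] at e
  rw [e]
  congr 1
  refine intervalIntegral.integral_congr fun t _ => ?_
  have : c t = - d' t := eq_neg_of_add_eq_zero_left (e1 t)
  simp only [e2, this, smul_sub, neg_smul, smul_smul, mul_comm μ]
  abel

theorem hasDerivAt_linear_arg (ρ : ℂ) (x t : ℝ) :
    HasDerivAt (fun t : ℝ => ρ * ((x : ℂ) - t)) (-ρ) t := by
  have := ((Complex.ofRealCLM.hasDerivAt (x := t)).const_sub (x : ℂ)).const_mul ρ
  simpa using this

theorem variation {ρ : ℂ} (hρ : ρ ≠ 0) (h : IsSol q (ρ ^ 2) X Y Z) {x : ℝ} (hx : x ∈ Icc 0 X) :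
    Y x = Complex.cos (ρ * x) • Y 0 + (Complex.sin (ρ * x) / ρ) • Z 0 +
      ∫ t in (0)..x, (Complex.sin (ρ * (x - t)) / ρ) • (q t * Y t) := by
  have := h.smul_cos_add (c := fun t => Complex.cos (ρ * (x - t)))
    (d := fun t => Complex.sin (ρ * (x - t)) / ρ)
    (c' := fun t => -Complex.sin (ρ * (x - t)) * -ρ)
    (d' := fun t => Complex.cos (ρ * (x - t)) * -ρ / ρ) (x := x)
    (fun t => (Complex.hasDerivAt_cos _).comp t (hasDerivAt_linear_arg ρ x t))
    (fun t => ((Complex.hasDerivAt_sin _).comp t (hasDerivAt_linear_arg ρ x t)).div_const ρ)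
    (by fun_prop) (by fun_prop) (fun t => by field_simp; ring) (fun t => by field_simp) hx
  simpa using this

theorem variation' {ρ : ℂ} (h : IsSol q (ρ ^ 2) X Y Z) {x : ℝ} (hx : x ∈ Icc 0 X) :
    Z x = (-ρ * Complex.sin (ρ * x)) • Y 0 + Complex.cos (ρ * x) • Z 0 +
      ∫ t in (0)..x, Complex.cos (ρ * (x - t)) • (q t * Y t) := by
  have := h.smul_cos_add (c := fun t => -ρ * Complex.sin (ρ * (x - t)))
    (d := fun t => Complex.cos (ρ * (x - t)))
    (c' := fun t => -ρ * (Complex.cos (ρ * (x - t)) * -ρ))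
    (d' := fun t => -Complex.sin (ρ * (x - t)) * -ρ) (x := x)
    (fun t => ((Complex.hasDerivAt_sin _).comp t (hasDerivAt_linear_arg ρ x t)).const_mul (-ρ))
    (fun t => (Complex.hasDerivAt_cos _).comp t (hasDerivAt_linear_arg ρ x t))
    (by fun_prop) (by fun_prop) (fun t => by ring) (fun t => by ring) hx
  simpa using this

theorem norm_integral_smul_le (hq : IntegrableOn q (Ioi 0)) {k : ℝ → ℂ} {s b g x : ℝ}
    (hx : 0 ≤ x) (hb : 0 ≤ b)
    (hk : ∀ t ∈ Icc 0 x, ‖k t‖ ≤ b * Real.exp (s * (x - t)))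
    (hY : ∀ t ∈ Icc 0 x, ‖Y t‖ ≤ g * Real.exp (s * t)) :
    ‖∫ t in (0)..x, k t • (q t * Y t)‖ ≤
      b * (∫ t in Ioi 0, ‖q t‖) * g * Real.exp (s * x) := by
  have hg : 0 ≤ g := by
    have := (norm_nonneg _).trans (hY 0 ⟨le_rfl, hx⟩)
    simpa using this
  have hi : IntervalIntegrable (fun t => ‖q t‖) volume 0 x := by
    rw [intervalIntegrable_iff_integrableOn_Ioc_of_le hx]
    exact (hq.mono_set Ioc_subset_Ioi_self).norm
  have h1 : ‖∫ t in (0)..x, k t • (q t * Y t)‖ ≤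
      ∫ t in (0)..x, b * g * Real.exp (s * x) * ‖q t‖ := by
    refine intervalIntegral.norm_integral_le_of_norm_le hx (Eventually.of_forall fun t ht => ?_)
      (hi.const_mul _)
    have ht' := Ioc_subset_Icc_self ht
    calc ‖k t • (q t * Y t)‖ ≤ ‖k t‖ * (‖q t‖ * ‖Y t‖) := by
          rw [norm_smul]; gcongr; exact norm_mul_le _ _
      _ ≤ (b * Real.exp (s * (x - t))) * (‖q t‖ * (g * Real.exp (s * t))) := by
          gcongr
          · exact hk t ht'
          · exact hY t ht'
      _ = b * g * (Real.exp (s * (x - t)) * Real.exp (s * t)) * ‖q t‖ := by ring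
      _ = _ := by rw [← Real.exp_add]; ring_nf
  refine h1.trans ?_
  rw [intervalIntegral.integral_const_mul, intervalIntegral.integral_of_le hx]
  have : ∫ t in Ioc 0 x, ‖q t‖ ≤ ∫ t in Ioi 0, ‖q t‖ :=
    setIntegral_mono_set hq.norm (Eventually.of_forall fun _ => norm_nonneg _)
      Ioc_subset_Ioi_self.eventuallyLE
  calc _ ≤ b * g * Real.exp (s * x) * ∫ t in Ioi 0, ‖q t‖ := by gcongr
    _ = _ := by ring

/-- Let `g` be the maximum of `‖Y t‖ exp(-t Im ρ)`. Variation of constants at the maximum point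
bounds `g` by the initial data plus `g / 2`, since `|ρ|` is large; the half is absorbed, whence the
factor `2`. -/
theorem norm_le {ρ : ℂ} (hq : IntegrableOn q (Ioi 0)) (hρ : ρ ≠ 0) (him : 0 ≤ ρ.im)
    (hK : 2 * ∫ t in Ioi 0, ‖q t‖ ≤ ‖ρ‖) (h : IsSol q (ρ ^ 2) X Y Z) {x : ℝ} (hx : x ∈ Icc 0 X) :
    ‖Y x‖ ≤ 2 * (‖Y 0‖ + ‖Z 0‖ / ‖ρ‖) * Real.exp (ρ.im * x) := by
  have hX : 0 ≤ X := hx.1.trans hx.2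
  have hρ0 : 0 < ‖ρ‖ := norm_pos_iff.2 hρ
  set K := ∫ t in Ioi 0, ‖q t‖
  have him' : ∀ {s : ℝ}, 0 ≤ s → |(ρ * (s : ℂ)).im| ≤ ρ.im * s := by
    intro s hs
    rw [Complex.im_mul_ofReal, abs_of_nonneg (mul_nonneg him hs)]
  have hc : ContinuousOn (fun t => ‖Y t‖ * Real.exp (-(ρ.im * t))) (Icc 0 X) :=
    h.prim.continuousOn.norm.mul (by fun_prop)
  obtain ⟨x0, hx0, hmax⟩ := isCompact_Icc.exists_isMaxOn ⟨0, le_rfl, hX⟩ hc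
  set g := ‖Y x0‖ * Real.exp (-(ρ.im * x0)) with hg
  have hYg : ∀ t ∈ Icc 0 X, ‖Y t‖ ≤ g * Real.exp (ρ.im * t) := by
    intro t ht
    have : ‖Y t‖ * Real.exp (-(ρ.im * t)) ≤ g := hmax ht
    calc ‖Y t‖ = ‖Y t‖ * Real.exp (-(ρ.im * t)) * Real.exp (ρ.im * t) := by
          rw [mul_assoc, ← Real.exp_add]; simp
      _ ≤ _ := by gcongr
  have hi := norm_integral_smul_le (Y := Y) hq (k := fun t => Complex.sin (ρ * (x0 - t)) / ρ)
    (b := ‖ρ‖⁻¹) (s := ρ.im) (g := g) hx0.1 (by positivity) (fun t ht => by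
      have := norm_sin_le_exp _ (him' (s := x0 - t) (by linarith [ht.2]))
      rw [norm_div, div_eq_inv_mul]
      gcongr
      simpa using this) (fun t ht => hYg t ⟨ht.1, ht.2.trans hx0.2⟩)
  have hb : ‖Y x0‖ ≤ (‖Y 0‖ + ‖Z 0‖ / ‖ρ‖ + ‖ρ‖⁻¹ * K * g) * Real.exp (ρ.im * x0) := by
    have c1 := norm_cos_le_exp _ (him' hx0.1)
    have c2 := norm_sin_le_exp _ (him' hx0.1)
    calc ‖Y x0‖ = _ := congrArg norm (h.variation hρ hx0)
      _ ≤ ‖Complex.cos (ρ * x0)‖ * ‖Y 0‖ + ‖Complex.sin (ρ * x0)‖ / ‖ρ‖ * ‖Z 0‖ +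
          ‖ρ‖⁻¹ * K * g * Real.exp (ρ.im * x0) := by
        refine (norm_add_le _ _).trans (add_le_add ((norm_add_le _ _).trans ?_) hi)
        rw [norm_smul, norm_smul, norm_div]
      _ ≤ Real.exp (ρ.im * x0) * ‖Y 0‖ + Real.exp (ρ.im * x0) / ‖ρ‖ * ‖Z 0‖ +
          ‖ρ‖⁻¹ * K * g * Real.exp (ρ.im * x0) := by gcongr
      _ = _ := by ring
  have hg0 : 0 ≤ g := by positivity
  have hgb : g ≤ ‖Y 0‖ + ‖Z 0‖ / ‖ρ‖ + ‖ρ‖⁻¹ * K * g := by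
    have hge : g * Real.exp (ρ.im * x0) = ‖Y x0‖ := by
      rw [hg, mul_assoc, ← Real.exp_add]; simp
    exact le_of_mul_le_mul_right (hge.trans_le hb) (Real.exp_pos _)
  have hKρ : ‖ρ‖⁻¹ * K * g ≤ g / 2 := by
    have : ‖ρ‖⁻¹ * K ≤ 1 / 2 := by
      rw [inv_mul_le_iff₀ hρ0]; linarith
    calc _ ≤ 1 / 2 * g := by gcongr
      _ = _ := by ring
  refine (hYg x hx).trans ?_
  gcongr
  linarith

theorem norm_deriv_le {ρ : ℂ} (hq : IntegrableOn q (Ioi 0)) (hρ : ρ ≠ 0) (him : 0 ≤ ρ.im)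
    (hK : 2 * ∫ t in Ioi 0, ‖q t‖ ≤ ‖ρ‖) (h : IsSol q (ρ ^ 2) X Y Z) {x : ℝ} (hx : x ∈ Icc 0 X) :
    ‖Z x‖ ≤ 2 * ‖ρ‖ * (‖Y 0‖ + ‖Z 0‖ / ‖ρ‖) * Real.exp (ρ.im * x) := by
  have hX : 0 ≤ X := hx.1.trans hx.2
  have hρ0 : 0 < ‖ρ‖ := norm_pos_iff.2 hρ
  set K := ∫ t in Ioi 0, ‖q t‖
  have him' : ∀ {s : ℝ}, 0 ≤ s → |(ρ * (s : ℂ)).im| ≤ ρ.im * s := by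
    intro s hs
    rw [Complex.im_mul_ofReal, abs_of_nonneg (mul_nonneg him hs)]
  have hi := norm_integral_smul_le (Y := Y) hq (k := fun t => Complex.cos (ρ * (x - t)))
    (b := 1) (s := ρ.im) hx.1 zero_le_one (fun t ht => by
      have := norm_cos_le_exp _ (him' (s := x - t) (by linarith [ht.2]))
      simpa using this) (fun t ht => h.norm_le hq hρ him hK ⟨ht.1, ht.2.trans hx.2⟩)
  have c1 := norm_cos_le_exp _ (him' hx.1)
  have c2 := norm_sin_le_exp _ (him' hx.1)
  calc ‖Z x‖ = _ := congrArg norm (h.variation' hx)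
    _ ≤ ‖ρ‖ * ‖Complex.sin (ρ * x)‖ * ‖Y 0‖ + ‖Complex.cos (ρ * x)‖ * ‖Z 0‖ +
        1 * K * (2 * (‖Y 0‖ + ‖Z 0‖ / ‖ρ‖)) * Real.exp (ρ.im * x) := by
      refine (norm_add_le _ _).trans (add_le_add ((norm_add_le _ _).trans ?_) hi)
      rw [norm_smul, norm_smul, norm_mul, norm_neg]
    _ ≤ ‖ρ‖ * Real.exp (ρ.im * x) * ‖Y 0‖ + Real.exp (ρ.im * x) * ‖Z 0‖ +
        1 * (‖ρ‖ / 2) * (2 * (‖Y 0‖ + ‖Z 0‖ / ‖ρ‖)) * Real.exp (ρ.im * x) := by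
      gcongr; linarith
    _ = _ := by field_simp; ring

/-- The growth bounds are linear in the initial data, so they force the difference to vanish. -/
theorem eqOn_of_initial {ρ : ℂ} (hq : IntegrableOn q (Ioi 0)) (hρ : ρ ≠ 0) (him : 0 ≤ ρ.im)
    (hK : 2 * ∫ t in Ioi 0, ‖q t‖ ≤ ‖ρ‖) (h : IsSol q (ρ ^ 2) X Y Z)
    (h' : IsSol q (ρ ^ 2) X Y' Z') (h0 : Y 0 = Y' 0) (h1 : Z 0 = Z' 0) {x : ℝ}
    (hx : x ∈ Icc 0 X) : Y x = Y' x ∧ Z x = Z' x := by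
  have a := (h.sub h').norm_le hq hρ him hK hx
  have b := (h.sub h').norm_deriv_le hq hρ him hK hx
  simp only [h0, h1, sub_self, norm_zero, zero_div, add_zero, mul_zero, zero_mul,
    norm_le_zero_iff, sub_eq_zero] at a b
  exact ⟨a, b⟩

end IsSol

end Algebra

/-! ### Analytic dependence on the spectral parameter -/

section Operator

variable {E : Type*} [NormedAddCommGroup E] [NormedSpace ℂ E] [CompleteSpace E]

/-- The solution of a linear equation depends analytically on the parameter if, for each bound on
the parameter, the operators become small after a similarity. -/
theorem exists_entire_solution (V₀ V₁ : E →L[ℂ] E)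
    (h : ∀ b : ℝ, 0 ≤ b → ∃ W V₀' V₁' : E →L[ℂ] E, IsUnit W ∧ W * V₀ = V₀' * W ∧
      W * V₁ = V₁' * W ∧ ‖V₀'‖ + b * ‖V₁'‖ < 1) (y₀ : E) :
    ∃ y : ℂ → E, Differentiable ℂ y ∧ ∀ μ, y μ = y₀ + (V₀ (y μ) - μ • V₁ (y μ)) := by
  have hu : ∀ μ : ℂ, IsUnit (1 - (V₀ - μ • V₁)) := by
    intro μ
    obtain ⟨W, V₀', V₁', hW, h0, h1, hlt⟩ := h ‖μ‖ (norm_nonneg _)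
    have hV : ‖V₀' - μ • V₁'‖ < 1 :=
      ((norm_sub_le _ _).trans (by rw [norm_smul])).trans_lt hlt
    -- The similarity carries the operator to one of the form `1 - V` with `‖V‖ < 1`, invertible by
    -- the Neumann series. Invertibility passes back because `W` is a unit.
    have key : W * (1 - (V₀ - μ • V₁)) = (1 - (V₀' - μ • V₁')) * W := by
      rw [mul_sub, mul_sub, mul_smul_comm, h0, h1, sub_mul, sub_mul, smul_mul_assoc, mul_one,
        one_mul]
    rw [← hW.mul_left_iff, key]
    exact (isUnit_one_sub_of_norm_lt_one hV).mul hW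
  refine ⟨fun μ => Ring.inverse (1 - (V₀ - μ • V₁)) y₀, fun μ => ?_, fun μ => ?_⟩
  · have hd : Differentiable ℂ fun μ : ℂ => 1 - (V₀ - μ • V₁) :=
      (differentiable_const _).sub ((differentiable_const _).sub (differentiable_id.smul_const _))
    exact ((hd μ).inverse (hu μ)).clm_apply (differentiableAt_const y₀)
  · have e := congrArg (fun T : E →L[ℂ] E => T y₀) (Ring.mul_inverse_cancel _ (hu μ))
    simp only [mul_apply_eq_comp, one_apply_eq_self, sub_apply, smul_apply] at e
    exact sub_eq_iff_eq_add.1 e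

end Operator

section Volterra

open BoundedContinuousFunction

variable {𝔸 : Type*} [NormedRing 𝔸] [NormedAlgebra ℂ 𝔸] [CompleteSpace 𝔸]
  {ν : Measure ℝ} {q : ℝ → 𝔸}

theorem integrable_kernel (K : ℝ × ℝ →ᵇ ℂ) (hq : Integrable q ν) (f : ℝ →ᵇ 𝔸) (x : ℝ) :
    Integrable (fun t => K (x, t) • (q t * f t)) ν := by
  have h1 : Integrable (fun t => q t * f t) ν := by
    refine hq.smul_bdd ‖f‖ f.continuous.aestronglyMeasurable ?_
    exact Eventually.of_forall fun t => f.norm_coe_le_norm t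
  refine h1.bdd_smul (φ := fun t => K (x, t)) ‖K‖ ?_ ?_
  · exact (K.continuous.comp (by fun_prop : Continuous fun t : ℝ => (x, t))).aestronglyMeasurable
  · exact Eventually.of_forall fun t => K.norm_coe_le_norm _

theorem norm_kernel_le (K : ℝ × ℝ →ᵇ ℂ) (f : ℝ →ᵇ 𝔸) (x t : ℝ) :
    ‖K (x, t) • (q t * f t)‖ ≤ ‖K‖ * ‖f‖ * ‖q t‖ := by
  calc _ ≤ ‖K (x, t)‖ * (‖q t‖ * ‖f t‖) := by
        rw [norm_smul]; gcongr; exact norm_mul_le _ _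
    _ ≤ ‖K‖ * (‖q t‖ * ‖f‖) := by
        gcongr
        · exact K.norm_coe_le_norm _
        · exact f.norm_coe_le_norm t
    _ = _ := by ring

theorem norm_integral_kernel_le (K : ℝ × ℝ →ᵇ ℂ) (hq : Integrable q ν) (f : ℝ →ᵇ 𝔸) (x : ℝ) :
    ‖∫ t, K (x, t) • (q t * f t) ∂ν‖ ≤ ‖K‖ * (∫ t, ‖q t‖ ∂ν) * ‖f‖ := by
  refine (norm_integral_le_of_norm_le (hq.norm.const_mul _)
    (Eventually.of_forall fun t => norm_kernel_le K f x t)).trans_eq ?_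
  rw [integral_const_mul]; ring

/-- The integral operator `f ↦ ∫ K(x, t) q(t) f(t) dν(t)` on bounded continuous functions. -/
noncomputable def kernelOp (K : ℝ × ℝ →ᵇ ℂ) (hq : Integrable q ν) :
    (ℝ →ᵇ 𝔸) →L[ℂ] (ℝ →ᵇ 𝔸) :=
  LinearMap.mkContinuous
    { toFun := fun f => ofNormedAddCommGroup (fun x => ∫ t, K (x, t) • (q t * f t) ∂ν)
        (continuous_of_dominated (fun x => (integrable_kernel K hq f x).aestronglyMeasurable)
          (fun x => Eventually.of_forall fun t => norm_kernel_le K f x t)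
          (hq.norm.const_mul _)
          (Eventually.of_forall fun t =>
            (K.continuous.comp (by fun_prop : Continuous fun x : ℝ => (x, t))).smul
              continuous_const))
        (‖K‖ * (∫ t, ‖q t‖ ∂ν) * ‖f‖)
        (norm_integral_kernel_le K hq f)
      map_add' := fun f g => by
        ext x
        simp only [coe_ofNormedAddCommGroup, BoundedContinuousFunction.coe_add, Pi.add_apply,
          mul_add, smul_add]
        exact integral_add (integrable_kernel K hq f x) (integrable_kernel K hq g x)
      map_smul' := fun c f => by
        ext x
        simp only [coe_ofNormedAddCommGroup, BoundedContinuousFunction.coe_smul,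
          RingHom.id_apply, mul_smul_comm, smul_comm _ c]
        exact integral_smul c _ }
    (‖K‖ * ∫ t, ‖q t‖ ∂ν)
    (fun f => norm_ofNormedAddCommGroup_le _ (by positivity) (norm_integral_kernel_le K hq f))

theorem kernelOp_apply (K : ℝ × ℝ →ᵇ ℂ) (hq : Integrable q ν) (f : ℝ →ᵇ 𝔸) (x : ℝ) :
    kernelOp K hq f x = ∫ t, K (x, t) • (q t * f t) ∂ν := rfl

theorem kernelOp_sub_smul_apply (K : ℝ × ℝ →ᵇ ℂ) {r : ℝ → 𝔸} (hq : Integrable q ν)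
    (hr : Integrable r ν) (f : ℝ →ᵇ 𝔸) (μ : ℂ) (x : ℝ) :
    kernelOp K hq f x - μ • kernelOp K hr f x =
      ∫ t, K (x, t) • (q t * f t - μ • (r t * f t)) ∂ν := by
  have h2 : Integrable (fun t => μ • (K (x, t) • (r t * f t))) ν :=
    (integrable_kernel K hr f x).smul μ
  rw [kernelOp_apply, kernelOp_apply, ← integral_smul,
    ← integral_sub (integrable_kernel K hq f x) h2]
  simp only [smul_sub, smul_comm μ]

theorem norm_kernelOp_le (K : ℝ × ℝ →ᵇ ℂ) (hq : Integrable q ν) :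
    ‖kernelOp K hq‖ ≤ ‖K‖ * ∫ t, ‖q t‖ ∂ν :=
  LinearMap.mkContinuous_norm_le _ (by positivity) fun f =>
    norm_ofNormedAddCommGroup_le _ (by positivity) (norm_integral_kernel_le K hq f)

/-- The retraction of the line onto `[0, X]`. -/
noncomputable def clamp (X x : ℝ) : ℝ := max 0 (min x X)

theorem continuous_clamp (X : ℝ) : Continuous (clamp X) := by unfold clamp; fun_prop

theorem clamp_of_mem {X x : ℝ} (hx : x ∈ Icc 0 X) : clamp X x = x := by
  rw [clamp, min_eq_left hx.2, max_eq_right hx.1]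

theorem clamp_nonneg (X x : ℝ) : 0 ≤ clamp X x := le_max_left _ _

theorem clamp_le {X : ℝ} (hX : 0 ≤ X) (x : ℝ) : clamp X x ≤ X := max_le hX (min_le_right _ _)

/-- The kernel `(x - t)₊ exp(-m (x - t)₊)` for `x, t ∈ [0, X]`. -/
noncomputable def volterraKernel (X m : ℝ) (hX : 0 ≤ X) (hm : 0 ≤ m) : ℝ × ℝ →ᵇ ℂ :=
  ofNormedAddCommGroup
    (fun p => ((max (clamp X p.1 - clamp X p.2) 0 *
      Real.exp (-(m * max (clamp X p.1 - clamp X p.2) 0)) : ℝ) : ℂ))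
    (by
      have h1 := (continuous_clamp X).comp (continuous_fst : Continuous (Prod.fst : ℝ × ℝ → ℝ))
      have h2 := (continuous_clamp X).comp (continuous_snd : Continuous (Prod.snd : ℝ × ℝ → ℝ))
      simp only [Function.comp_def] at h1 h2
      fun_prop) X
    (fun p => by
      set s := max (clamp X p.1 - clamp X p.2) 0 with hs
      have hs0 : 0 ≤ s := le_max_right _ _
      have hsX : s ≤ X := max_le (by linarith [clamp_le hX p.1, clamp_nonneg X p.2]) hX
      rw [Complex.norm_real, Real.norm_of_nonneg (by positivity)]
      calc s * Real.exp (-(m * s)) ≤ s * 1 := by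
            gcongr; exact Real.exp_le_one_iff.2 (by nlinarith)
        _ ≤ X := by linarith)

theorem volterraKernel_apply {X m : ℝ} (hX : 0 ≤ X) (hm : 0 ≤ m) (x t : ℝ) :
    volterraKernel X m hX hm (x, t) = ((max (clamp X x - clamp X t) 0 *
      Real.exp (-(m * max (clamp X x - clamp X t) 0)) : ℝ) : ℂ) := rfl

theorem norm_volterraKernel_le {X m : ℝ} (hX : 0 ≤ X) (hm : 0 < m) :
    ‖volterraKernel X m hX hm.le‖ ≤ m⁻¹ := by
  rw [BoundedContinuousFunction.norm_le (by positivity)]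
  rintro ⟨x, t⟩
  rw [volterraKernel_apply]
  set s := max (clamp X x - clamp X t) 0
  have hs0 : 0 ≤ s := le_max_right _ _
  rw [Complex.norm_real, Real.norm_of_nonneg (by positivity), Real.exp_neg, ← div_eq_mul_inv,
    div_le_iff₀ (Real.exp_pos _), le_inv_mul_iff₀ hm]
  linarith [Real.add_one_le_exp (m * s)]

/-- Multiplication by `exp(m x)` on `[0, X]`. -/
noncomputable def weightOp (𝔸 : Type*) [NormedRing 𝔸] [NormedAlgebra ℂ 𝔸] (X m : ℝ)
    (hX : 0 ≤ X) : (ℝ →ᵇ 𝔸) →L[ℂ] (ℝ →ᵇ 𝔸) :=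
  ContinuousLinearMap.mul ℂ (ℝ →ᵇ 𝔸)
    (ofNormedAddCommGroup (fun x => algebraMap ℂ 𝔸 (Real.exp (m * clamp X x) : ℝ))
      (by
        have := continuous_clamp X
        have h2 : Continuous (algebraMap ℂ 𝔸) := continuous_algebraMap ℂ 𝔸
        fun_prop) (Real.exp (|m| * X) * ‖(1 : 𝔸)‖)
      (fun x => by
        rw [norm_algebraMap, Complex.norm_real, Real.norm_of_nonneg (Real.exp_pos _).le]
        gcongr
        · exact clamp_nonneg X x
        · exact le_abs_self m
        · exact clamp_le hX x))

theorem weightOp_apply {X m : ℝ} (hX : 0 ≤ X) (f : ℝ →ᵇ 𝔸) (x : ℝ) :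
    weightOp 𝔸 X m hX f x = ((Real.exp (m * clamp X x) : ℝ) : ℂ) • f x := by
  simp only [weightOp, ContinuousLinearMap.mul_apply', BoundedContinuousFunction.coe_mul,
    Pi.mul_apply, coe_ofNormedAddCommGroup, Algebra.smul_def]

theorem weightOp_mul_weightOp_neg {X : ℝ} (m : ℝ) (hX : 0 ≤ X) :
    weightOp 𝔸 X m hX * weightOp 𝔸 X (-m) hX = 1 := by
  ext f x
  rw [mul_apply_eq_comp, weightOp_apply, weightOp_apply, smul_smul,
    ← Complex.ofReal_mul, ← Real.exp_add]
  simp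

theorem isUnit_weightOp {X : ℝ} (m : ℝ) (hX : 0 ≤ X) : IsUnit (weightOp 𝔸 X m hX) :=
  ⟨⟨_, _, weightOp_mul_weightOp_neg m hX, by
    simpa using weightOp_mul_weightOp_neg (𝔸 := 𝔸) (-m) hX⟩, rfl⟩

/-- Since `exp(-m x) = exp(-m (x - t)) exp(-m t)`, conjugation by the weight puts a factor `exp(-m
(x - t))` into the kernel; where `x ≤ t` both kernels vanish. -/
theorem weightOp_mul_kernelOp {X m : ℝ} (hX : 0 ≤ X) (hm : 0 ≤ m) (hq : Integrable q ν) :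
    weightOp 𝔸 X (-m) hX * kernelOp (volterraKernel X 0 hX le_rfl) hq =
      kernelOp (volterraKernel X m hX hm) hq * weightOp 𝔸 X (-m) hX := by
  ext f x
  simp only [mul_apply_eq_comp, weightOp_apply, kernelOp_apply]
  rw [← integral_smul]
  congr 1
  ext t
  rw [mul_smul_comm, smul_smul, smul_smul, volterraKernel_apply, volterraKernel_apply]
  congr 1
  norm_cast
  rcases le_total (clamp X x) (clamp X t) with h | h
  · simp [max_eq_right (sub_nonpos.2 h)]
  · have e : Real.exp (-m * clamp X x) =
        Real.exp (-(m * (clamp X x - clamp X t))) * Real.exp (-m * clamp X t) := by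
      rw [← Real.exp_add]; ring_nf
    rw [max_eq_left (sub_nonneg.2 h), e, zero_mul, neg_zero, Real.exp_zero]
    ring

theorem exists_intertwining {X : ℝ} (hX : 0 ≤ X) {r : ℝ → 𝔸} (hq : Integrable q ν)
    (hr : Integrable r ν) {b : ℝ} (hb : 0 ≤ b) :
    ∃ W V₀ V₁ : (ℝ →ᵇ 𝔸) →L[ℂ] (ℝ →ᵇ 𝔸), IsUnit W ∧
      W * kernelOp (volterraKernel X 0 hX le_rfl) hq = V₀ * W ∧
      W * kernelOp (volterraKernel X 0 hX le_rfl) hr = V₁ * W ∧ ‖V₀‖ + b * ‖V₁‖ < 1 := by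
  -- The damped kernel has norm at most `1 / m`, because `s exp(-m s) ≤ 1 / m`. With `m = c + 1` the
  -- sum of norms is at most `c / (c + 1) < 1`.
  set c := (∫ t, ‖q t‖ ∂ν) + b * ∫ t, ‖r t‖ ∂ν with hc
  have hc0 : 0 ≤ c := by positivity
  have hm : 0 < c + 1 := by linarith
  refine ⟨weightOp 𝔸 X (-(c + 1)) hX, kernelOp (volterraKernel X (c + 1) hX hm.le) hq,
    kernelOp (volterraKernel X (c + 1) hX hm.le) hr, isUnit_weightOp _ hX,
    weightOp_mul_kernelOp hX hm.le hq, weightOp_mul_kernelOp hX hm.le hr, ?_⟩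
  have hk := norm_volterraKernel_le hX hm
  calc _ ≤ (c + 1)⁻¹ * (∫ t, ‖q t‖ ∂ν) + b * ((c + 1)⁻¹ * ∫ t, ‖r t‖ ∂ν) := by
        refine add_le_add ?_ ?_
        · exact (norm_kernelOp_le _ hq).trans (by gcongr)
        · gcongr
          exact (norm_kernelOp_le _ hr).trans (by gcongr)
    _ = (c + 1)⁻¹ * c := by rw [hc]; ring
    _ < 1 := by rw [inv_mul_lt_iff₀ hm]; linarith

/-- Integration by parts: the boundary terms vanish because `X - t` is zero at `X` and the primitive
is zero at `0`. -/
theorem integral_sub_smul_eq {X : ℝ} {g : ℝ → 𝔸} (hg : IntervalIntegrable g volume 0 X)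
    (hX : 0 ≤ X) :
    ∫ t in (0)..X, ((X - t : ℝ) : ℂ) • g t = ∫ t in (0)..X, ∫ s in (0)..t, g s := by
  have p : IsPrimitive (fun t => ∫ s in (0)..t, g s) g X := ⟨hg, fun x _ => by simp⟩
  have pc : IsPrimitive (fun t : ℝ => ((X - t : ℝ) : ℂ)) (fun _ => -1) X :=
    IsPrimitive.of_hasDerivAt (fun t => by
      have := ((hasDerivAt_id t).const_sub X).ofReal_comp
      simpa using this) continuous_const
  have w := pc.bilin p (ContinuousLinearMap.lsmul ℝ ℂ) hX
  have e := w.eq X ⟨hX, le_rfl⟩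
  have i1 : IntervalIntegrable (fun t => ∫ s in (0)..t, g s) volume 0 X :=
    ContinuousOn.intervalIntegrable (by rw [uIcc_of_le hX]; exact p.continuousOn)
  have i2 : IntervalIntegrable (fun t => ((X - t : ℝ) : ℂ) • g t) volume 0 X := by
    convert! w.integrable.add i1 using 2
    rw [ContinuousLinearMap.lsmul_apply, ContinuousLinearMap.lsmul_apply, neg_smul, one_smul]
    abel
  simp only [ContinuousLinearMap.lsmul_apply, neg_smul, one_smul, sub_self, Complex.ofReal_zero,
    zero_smul, intervalIntegral.integral_same, smul_zero, zero_add] at e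
  have i1' : IntervalIntegrable (fun t => -∫ s in (0)..t, g s) volume 0 X := i1.neg
  rw [intervalIntegral.integral_add i1' i2, intervalIntegral.integral_neg] at e
  exact (neg_add_eq_zero.1 e.symm).symm

/-- The initial value problem amounts to `Y(x) = a + x b + ∫₀ˣ (x - t)(q - μ) Y dt`, whose operator
is affine in `μ`. The weight trick makes it uniquely solvable for every `μ`, which is what makes the
solution entire. -/
theorem exists_entire_isSol (hq : IntegrableOn q (Ioi 0)) {X : ℝ} (hX : 0 ≤ X) (a b : 𝔸) :
    ∃ Y Z : ℂ → ℝ → 𝔸, (∀ μ, IsSol q μ X (Y μ) (Z μ) ∧ Y μ 0 = a ∧ Z μ 0 = b) ∧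
      Differentiable ℂ (fun μ => Y μ X) ∧ Differentiable ℂ (fun μ => Z μ X) := by
  have hqX : Integrable q (volume.restrict (Ioc 0 X)) := hq.mono_set Ioc_subset_Ioi_self
  have h1X : Integrable (fun _ => (1 : 𝔸)) (volume.restrict (Ioc 0 X)) := by
    exact integrable_const _
  let y0 : ℝ →ᵇ 𝔸 := ofNormedAddCommGroup (fun x => a + (clamp X x : ℂ) • b)
    (by have := continuous_clamp X; fun_prop) (‖a‖ + X * ‖b‖) (fun x => by
      refine (norm_add_le _ _).trans ?_
      rw [norm_smul, Complex.norm_real, Real.norm_of_nonneg (clamp_nonneg _ _)]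
      gcongr
      exact clamp_le hX x)
  obtain ⟨y, hyd, hy⟩ := exists_entire_solution (kernelOp (volterraKernel X 0 hX le_rfl) hqX)
    (kernelOp (volterraKernel X 0 hX le_rfl) h1X)
    (fun b hb => exists_intertwining hX hqX h1X hb) y0
  have hyeq : ∀ μ x, y μ x = a + (clamp X x : ℂ) • b +
      ((kernelOp (volterraKernel X 0 hX le_rfl) hqX (y μ)) x -
        μ • (kernelOp (volterraKernel X 0 hX le_rfl) h1X (y μ)) x) := fun μ x =>
    congrArg (fun f : ℝ →ᵇ 𝔸 => f x) (hy μ)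
  set g : ℂ → ℝ → 𝔸 := fun μ t => q t * y μ t - μ • y μ t with hg
  have hgi : ∀ μ, IntervalIntegrable (g μ) volume 0 X := fun μ => by
    rw [intervalIntegrable_iff_integrableOn_Ioc_of_le hX]
    have h1 := integrable_kernel (BoundedContinuousFunction.const _ 1) hqX (y μ) 0
    have h2 := integrable_kernel (BoundedContinuousFunction.const _ 1) h1X (y μ) 0
    simp only [BoundedContinuousFunction.const_apply, one_smul, one_mul] at h1 h2
    exact h1.sub (h2.smul μ)
  set z : ℂ → ℝ → 𝔸 := fun μ x => b + ∫ t in (0)..x, g μ t with hz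
  have hyx : ∀ μ, ∀ x ∈ Icc 0 X, y μ x = a + (x : ℂ) • b +
      ∫ t in (0)..x, ((x - t : ℝ) : ℂ) • g μ t := by
    intro μ x hx
    rw [hyeq, clamp_of_mem hx]
    congr 1
    rw [kernelOp_sub_smul_apply, intervalIntegral.integral_of_le hx.1]
    -- The kernel vanishes for `t ≥ x`, so the integral over `(0, X]` is really one over `(0, x]`.
    rw [setIntegral_eq_of_subset_of_forall_sdiff_eq_zero (s := Ioc 0 x) (t := Ioc 0 X)
      measurableSet_Ioc (Ioc_subset_Ioc_right hx.2)]
    · refine setIntegral_congr_fun measurableSet_Ioc fun t ht => ?_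
      have ht' : t ∈ Icc 0 X := ⟨ht.1.le, ht.2.trans hx.2⟩
      simp only [volterraKernel_apply, clamp_of_mem hx, clamp_of_mem ht',
        max_eq_left (sub_nonneg.2 ht.2), zero_mul, neg_zero, Real.exp_zero, mul_one, one_mul, hg]
    · intro t ht
      have ht' : t ∈ Icc 0 X := Ioc_subset_Icc_self ht.1
      have hxt : x ≤ t := by
        by_contra hlt
        exact ht.2 ⟨ht.1.1, (not_le.1 hlt).le⟩
      simp [volterraKernel_apply, clamp_of_mem hx, clamp_of_mem ht',
        max_eq_right (sub_nonpos.2 hxt)]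
  have hy0 : ∀ μ, y μ 0 = a := fun μ => by rw [hyx μ 0 ⟨le_rfl, hX⟩]; simp
  refine ⟨fun μ => y μ, z, fun μ => ⟨⟨⟨?_, fun x hx => ?_⟩, ⟨hgi μ, fun x hx => ?_⟩⟩, hy0 μ, ?_⟩,
    ?_, ?_⟩
  · apply ContinuousOn.intervalIntegrable
    rw [uIcc_of_le hX]
    refine continuousOn_const.add ?_
    have := intervalIntegral.continuousOn_primitive_interval' (hgi μ) (a := 0) (by simp)
    rwa [uIcc_of_le hX] at this
  · have hgx : IntervalIntegrable (g μ) volume 0 x := (hgi μ).mono_set (by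
      rw [uIcc_of_le hX, uIcc_of_le hx.1]; exact Icc_subset_Icc_right hx.2)
    have hc : IntervalIntegrable (fun t => ∫ s in (0)..t, g μ s) volume 0 x :=
      ContinuousOn.intervalIntegrable (intervalIntegral.continuousOn_primitive_interval' hgx
        (by simp))
    dsimp only
    rw [hyx μ x hx, hy0, integral_sub_smul_eq hgx hx.1]
    simp only [hz]
    rw [intervalIntegral.integral_add intervalIntegrable_const hc,
      intervalIntegral.integral_const, sub_zero, add_assoc, Complex.coe_smul]
  · simp [hz, hg]
  · simp [hz]
  · exact (evalCLM ℂ X).differentiable.comp hyd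
  -- The constant kernel `1`, evaluated anywhere (here at `0`), gives the integral over all of `(0,
  -- X]`. Thus `Z` at `X` is built from continuous linear images of the entire function `y`.
  · have e : (fun μ => z μ X) = fun μ => b +
        (evalCLM ℂ 0 (kernelOp (BoundedContinuousFunction.const _ 1) hqX (y μ)) -
          μ • evalCLM ℂ 0 (kernelOp (BoundedContinuousFunction.const _ 1) h1X (y μ))) := by
      ext μ
      simp only [hz, evalCLM_apply]
      rw [kernelOp_sub_smul_apply, intervalIntegral.integral_of_le hX]
      simp [hg]
    rw [e]
    intro μ
    have d1 : ∀ T : (ℝ →ᵇ 𝔸) →L[ℂ] (ℝ →ᵇ 𝔸),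
        DifferentiableAt ℂ (fun μ => evalCLM ℂ (0 : ℝ) (T (y μ))) μ := fun T =>
      ((evalCLM ℂ (0 : ℝ)).comp T).differentiableAt.comp μ (hyd μ)
    exact (differentiableAt_const b).add ((d1 _).sub (differentiableAt_id.smul (d1 _)))

end Volterra

/-! ### Jost solutions for large `ρ`: existence, asymptotics, differential equation -/

theorem exists_eq_add_of_norm_lt_one {E : Type*} [NormedAddCommGroup E] [NormedSpace ℂ E]
    [CompleteSpace E] {V : E →L[ℂ] E} (hV : ‖V‖ < 1) (y₀ : E) : ∃ y, y = y₀ + V y := by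
  have hu := isUnit_one_sub_of_norm_lt_one hV
  refine ⟨Ring.inverse (1 - V) y₀, ?_⟩
  have e := congrArg (fun T : E →L[ℂ] E => T y₀) (Ring.mul_inverse_cancel _ hu)
  simp only [mul_apply_eq_comp, one_apply_eq_self, sub_apply] at e
  exact sub_eq_iff_eq_add.1 e

theorem norm_exp_I_mul (ρ : ℂ) (x : ℝ) :
    ‖Complex.exp (Complex.I * ρ * x)‖ = Real.exp (-(ρ.im * x)) := by
  rw [Complex.norm_exp]; simp [mul_assoc]

theorem abs_im_mul_ofReal {ρ : ℂ} (him : 0 ≤ ρ.im) {s : ℝ} (hs : 0 ≤ s) :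
    |(ρ * (s : ℂ)).im| ≤ ρ.im * s := by
  rw [Complex.im_mul_ofReal, abs_of_nonneg (mul_nonneg him hs)]

section Jost

open BoundedContinuousFunction

variable {𝔸 : Type*} [NormedRing 𝔸] [NormedAlgebra ℂ 𝔸] [CompleteSpace 𝔸]

/-- The Jost solution for a coefficient with values in a Banach algebra. -/
structure IsJost (q : ℝ → 𝔸) (ρ : ℂ) (e : ℝ → 𝔸) : Prop where
  continuousOn : ContinuousOn e (Ici 0)
  bounded : ∃ C : ℝ, ∀ x : ℝ, 0 ≤ x → ‖e x‖ ≤ C * ‖Complex.exp (Complex.I * ρ * x)‖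
  integral_eq : ∀ x : ℝ, 0 ≤ x →
    e x = Complex.exp (Complex.I * ρ * x) • (1 : 𝔸) +
      ∫ t in Ioi x, (Complex.sin (ρ * (t - x)) / ρ) • (q t * e t)

/-- The kernel `exp(iρs) sin(ρs) / ρ`, where `s = (t - x)₊`. -/
noncomputable def jostKernel (ρ : ℂ) (him : 0 ≤ ρ.im) : ℝ × ℝ →ᵇ ℂ :=
  ofNormedAddCommGroup
    (fun p => Complex.exp (Complex.I * ρ * (max (p.2 - p.1) 0 : ℝ)) *
      (Complex.sin (ρ * (max (p.2 - p.1) 0 : ℝ)) / ρ))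
    (by fun_prop) ‖ρ‖⁻¹
    (fun p => by
      have hs : 0 ≤ max (p.2 - p.1) 0 := le_max_right _ _
      rw [norm_mul, norm_div, norm_exp_I_mul, div_eq_mul_inv, ← mul_assoc]
      refine mul_le_of_le_one_left (by positivity) ?_
      calc _ ≤ Real.exp (-(ρ.im * max (p.2 - p.1) 0)) * Real.exp (ρ.im * max (p.2 - p.1) 0) := by
            gcongr; exact norm_sin_le_exp _ (abs_im_mul_ofReal him hs)
        _ = 1 := by rw [← Real.exp_add]; simp)

variable {q : ℝ → 𝔸} {ρ : ℂ}

/-- The function `f = exp(-iρx) e` satisfies `f = 1 + V f`, where `V` has a kernel bounded by `1 /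
|ρ|`. Largeness of `|ρ|` makes `V` a contraction. -/
theorem exists_isJost (hq : IntegrableOn q (Ioi 0)) (hρ : ρ ≠ 0) (him : 0 ≤ ρ.im)
    (hK : 2 * ∫ t in Ioi 0, ‖q t‖ ≤ ‖ρ‖) : ∃ e, IsJost q ρ e := by
  have hρ0 : 0 < ‖ρ‖ := norm_pos_iff.2 hρ
  have hV : ‖kernelOp (jostKernel ρ him) hq‖ < 1 := by
    refine (norm_kernelOp_le _ hq).trans_lt ?_
    calc _ ≤ ‖ρ‖⁻¹ * ∫ t in Ioi 0, ‖q t‖ := by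
          gcongr; exact norm_ofNormedAddCommGroup_le _ (by positivity) _
      _ < 1 := by rw [inv_mul_lt_iff₀ hρ0]; linarith
  obtain ⟨f, hf⟩ := exists_eq_add_of_norm_lt_one hV (1 : ℝ →ᵇ 𝔸)
  have hfx : ∀ x, f x = 1 + ∫ t in Ioi 0, jostKernel ρ him (x, t) • (q t * f t) := fun x =>
    congrArg (fun f : ℝ →ᵇ 𝔸 => f x) hf
  refine ⟨fun x => Complex.exp (Complex.I * ρ * x) • f x, ?_, ⟨‖f‖, fun x _ => ?_⟩,
    fun x hx => ?_⟩
  · have := f.continuous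
    fun_prop
  · rw [norm_smul, mul_comm]
    gcongr
    exact f.norm_coe_le_norm x
  · conv_lhs => rw [hfx x]
    rw [smul_add, ← integral_smul]
    congr 1
    rw [setIntegral_eq_of_subset_of_forall_sdiff_eq_zero (s := Ioi x) (t := Ioi 0)
      measurableSet_Ioi (Ioi_subset_Ioi hx)]
    · refine setIntegral_congr_fun measurableSet_Ioi fun t ht => ?_
      have hm : max (t - x) 0 = t - x := max_eq_left (sub_nonneg.2 (le_of_lt ht))
      have hk : jostKernel ρ him (x, t) = Complex.exp (Complex.I * ρ * (t - x)) *
          (Complex.sin (ρ * (t - x)) / ρ) := by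
        change Complex.exp (Complex.I * ρ * (max (t - x) 0 : ℝ)) *
          (Complex.sin (ρ * (max (t - x) 0 : ℝ)) / ρ) = _
        rw [hm, Complex.ofReal_sub]
      have he : Complex.exp (Complex.I * ρ * t) =
          Complex.exp (Complex.I * ρ * x) * Complex.exp (Complex.I * ρ * (t - x)) := by
        rw [← Complex.exp_add]; ring_nf
      simp only [hk, he, mul_smul_comm, smul_smul]
      congr 1
      ring
    · intro t ht
      have hm : max (t - x) 0 = 0 := max_eq_right (sub_nonpos.2 (not_lt.1 ht.2))
      have hk : jostKernel ρ him (x, t) = 0 := by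
        change Complex.exp (Complex.I * ρ * (max (t - x) 0 : ℝ)) *
          (Complex.sin (ρ * (max (t - x) 0 : ℝ)) / ρ) = _
        rw [hm]; simp
      rw [hk, zero_smul, smul_zero]

theorem norm_integral_Ioi_smul_le (hq : IntegrableOn q (Ioi 0)) {Y : ℝ → 𝔸} {k : ℝ → ℂ}
    {s b g x : ℝ} (hx : 0 ≤ x) (hb : 0 ≤ b)
    (hk : ∀ t, x ≤ t → ‖k t‖ ≤ b * Real.exp (s * (t - x)))
    (hY : ∀ t, x ≤ t → ‖Y t‖ ≤ g * Real.exp (-(s * t))) :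
    ‖∫ t in Ioi x, k t • (q t * Y t)‖ ≤
      b * (∫ t in Ioi 0, ‖q t‖) * g * Real.exp (-(s * x)) := by
  have hg : 0 ≤ g := nonneg_of_mul_nonneg_left ((norm_nonneg _).trans (hY x le_rfl))
    (Real.exp_pos _)
  have hi : IntegrableOn (fun t => ‖q t‖) (Ioi x) := (hq.mono_set (Ioi_subset_Ioi hx)).norm
  have h1 : ‖∫ t in Ioi x, k t • (q t * Y t)‖ ≤
      ∫ t in Ioi x, b * g * Real.exp (-(s * x)) * ‖q t‖ := by
    refine norm_integral_le_of_norm_le (hi.const_mul _) ?_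
    filter_upwards [ae_restrict_mem measurableSet_Ioi] with t ht
    have ht' : x ≤ t := le_of_lt ht
    calc ‖k t • (q t * Y t)‖ ≤ ‖k t‖ * (‖q t‖ * ‖Y t‖) := by
          rw [norm_smul]; gcongr; exact norm_mul_le _ _
      _ ≤ (b * Real.exp (s * (t - x))) * (‖q t‖ * (g * Real.exp (-(s * t)))) := by
          gcongr
          · exact hk t ht'
          · exact hY t ht'
      _ = b * g * (Real.exp (s * (t - x)) * Real.exp (-(s * t))) * ‖q t‖ := by ring
      _ = _ := by rw [← Real.exp_add]; ring_nf
  refine h1.trans ?_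
  rw [integral_const_mul]
  have : ∫ t in Ioi x, ‖q t‖ ≤ ∫ t in Ioi 0, ‖q t‖ :=
    setIntegral_mono_set hq.norm (Eventually.of_forall fun _ => norm_nonneg _)
      (Ioi_subset_Ioi hx).eventuallyLE
  calc _ ≤ b * g * Real.exp (-(s * x)) * ∫ t in Ioi 0, ‖q t‖ := by gcongr
    _ = _ := by ring

theorem isPrimitive_integral_Ioi {E : Type*} [NormedAddCommGroup E] [NormedSpace ℝ E]
    [CompleteSpace E] {w : ℝ → E} (hw : IntegrableOn w (Ioi 0)) {X : ℝ} (hX : 0 ≤ X) :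
    IsPrimitive (fun x => ∫ t in Ioi x, w t) (fun x => -w x) X := by
  refine ⟨?_, fun x hx => ?_⟩
  · rw [intervalIntegrable_iff_integrableOn_Ioc_of_le hX]
    exact (hw.mono_set Ioc_subset_Ioi_self).neg
  · rw [← intervalIntegral.integral_interval_add_Ioi hw (hw.mono_set (Ioi_subset_Ioi hx.1)),
      intervalIntegral.integral_neg]
    abel

namespace IsJost

variable {e : ℝ → 𝔸}

theorem norm_sub_le_of_bound (he : IsJost q ρ e) (hq : IntegrableOn q (Ioi 0)) (him : 0 ≤ ρ.im)
    {g : ℝ} (hg : ∀ t, 0 ≤ t → ‖e t‖ ≤ g * Real.exp (-(ρ.im * t))) {x : ℝ} (hx : 0 ≤ x) :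
    ‖e x - Complex.exp (Complex.I * ρ * x) • (1 : 𝔸)‖ ≤
      ‖ρ‖⁻¹ * (∫ t in Ioi 0, ‖q t‖) * g * Real.exp (-(ρ.im * x)) := by
  rw [he.integral_eq x hx, add_sub_cancel_left]
  refine norm_integral_Ioi_smul_le hq hx (by positivity) (fun t ht => ?_)
    (fun t ht => hg t (hx.trans ht))
  have := norm_sin_le_exp _ (abs_im_mul_ofReal him (sub_nonneg.2 ht))
  rw [norm_div, div_eq_inv_mul]
  gcongr
  simpa using this

theorem norm_le (he : IsJost q ρ e) (hq : IntegrableOn q (Ioi 0)) (hρ : ρ ≠ 0) (him : 0 ≤ ρ.im)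
    (hK : 2 * ∫ t in Ioi 0, ‖q t‖ ≤ ‖ρ‖) {x : ℝ} (hx : 0 ≤ x) :
    ‖e x‖ ≤ 2 * ‖(1 : 𝔸)‖ * Real.exp (-(ρ.im * x)) := by
  have hρ0 : 0 < ‖ρ‖ := norm_pos_iff.2 hρ
  set K := ∫ t in Ioi 0, ‖q t‖ with hKdef
  obtain ⟨C, hC⟩ := he.bounded
  -- On the half-line the weighted supremum need not be attained; its finiteness comes from the a
  -- priori bound in `IsJost`, and only then can half of it be absorbed.
  set s := (fun t => ‖e t‖ * Real.exp (ρ.im * t)) '' Ici 0 with hs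
  have hbdd : BddAbove s := by
    refine ⟨C, ?_⟩
    rintro _ ⟨t, ht, rfl⟩
    have := hC t ht
    rw [norm_exp_I_mul, Real.exp_neg, ← div_eq_mul_inv, le_div_iff₀ (Real.exp_pos _)] at this
    exact this
  have hg : ∀ t, 0 ≤ t → ‖e t‖ ≤ sSup s * Real.exp (-(ρ.im * t)) := by
    intro t ht
    rw [Real.exp_neg, ← div_eq_mul_inv, le_div_iff₀ (Real.exp_pos _)]
    exact le_csSup hbdd ⟨t, ht, rfl⟩
  have hg0 : 0 ≤ sSup s := Real.sSup_nonneg (by rintro _ ⟨t, _, rfl⟩; positivity)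
  have hle : sSup s ≤ ‖(1 : 𝔸)‖ + sSup s / 2 := by
    refine csSup_le ⟨_, 0, self_mem_Ici, rfl⟩ ?_
    rintro _ ⟨t, ht, rfl⟩
    have h1 := he.norm_sub_le_of_bound hq him hg ht
    have h2 : ‖ρ‖⁻¹ * K * sSup s ≤ sSup s / 2 := by
      have : ‖ρ‖⁻¹ * K ≤ 1 / 2 := by rw [inv_mul_le_iff₀ hρ0]; linarith
      calc _ ≤ 1 / 2 * sSup s := by gcongr
        _ = _ := by ring
    have h3 : ‖e t‖ ≤ (‖(1 : 𝔸)‖ + sSup s / 2) * Real.exp (-(ρ.im * t)) := by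
      calc ‖e t‖ ≤ ‖Complex.exp (Complex.I * ρ * t) • (1 : 𝔸)‖ +
            ‖e t - Complex.exp (Complex.I * ρ * t) • (1 : 𝔸)‖ := by
            simpa using norm_add_le (Complex.exp (Complex.I * ρ * t) • (1 : 𝔸))
              (e t - Complex.exp (Complex.I * ρ * t) • (1 : 𝔸))
        _ ≤ Real.exp (-(ρ.im * t)) * ‖(1 : 𝔸)‖ + sSup s / 2 * Real.exp (-(ρ.im * t)) := by
            rw [norm_smul, norm_exp_I_mul]
            gcongr
            exact h1.trans (by gcongr)
        _ = _ := by ring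
    rwa [Real.exp_neg, ← div_eq_mul_inv, le_div_iff₀ (Real.exp_pos _)] at h3
  refine (hg x hx).trans ?_
  gcongr
  linarith

theorem norm_sub_le (he : IsJost q ρ e) (hq : IntegrableOn q (Ioi 0)) (hρ : ρ ≠ 0)
    (him : 0 ≤ ρ.im) (hK : 2 * ∫ t in Ioi 0, ‖q t‖ ≤ ‖ρ‖) {x : ℝ} (hx : 0 ≤ x) :
    ‖e x - Complex.exp (Complex.I * ρ * x) • (1 : 𝔸)‖ ≤
      ‖ρ‖⁻¹ * (∫ t in Ioi 0, ‖q t‖) * (2 * ‖(1 : 𝔸)‖) * Real.exp (-(ρ.im * x)) :=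
  he.norm_sub_le_of_bound hq him (fun _ ht => he.norm_le hq hρ him hK ht) hx

theorem integrableOn_smul (he : IsJost q ρ e) (hq : IntegrableOn q (Ioi 0)) {k : ℝ → ℂ}
    (hk : Continuous k) (hkb : ∀ t, 0 ≤ t → ‖k t‖ ≤ Real.exp (ρ.im * t)) :
    IntegrableOn (fun t => k t • (q t * e t)) (Ioi 0) := by
  obtain ⟨C, hC⟩ := he.bounded
  have hem : AEStronglyMeasurable e (volume.restrict (Ioi 0)) :=
    (he.continuousOn.mono Ioi_subset_Ici_self).aestronglyMeasurable measurableSet_Ioi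
  refine Integrable.mono' (hq.norm.const_mul C)
    (hk.aestronglyMeasurable.smul (hq.aestronglyMeasurable.mul hem)) ?_
  filter_upwards [ae_restrict_mem measurableSet_Ioi] with t ht
  have ht' : 0 ≤ t := le_of_lt ht
  have h1 := hC t ht'
  rw [norm_exp_I_mul] at h1
  calc ‖k t • (q t * e t)‖ ≤ ‖k t‖ * (‖q t‖ * ‖e t‖) := by
        rw [norm_smul]; gcongr; exact norm_mul_le _ _
    _ ≤ Real.exp (ρ.im * t) * (‖q t‖ * (C * Real.exp (-(ρ.im * t)))) := by
        gcongr; exact hkb t ht'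
    _ = C * ‖q t‖ * (Real.exp (ρ.im * t) * Real.exp (-(ρ.im * t))) := by ring
    _ = _ := by rw [← Real.exp_add]; simp

end IsJost

/-- The derivative of the Jost solution `e`. -/
noncomputable def jostDeriv (q : ℝ → 𝔸) (ρ : ℂ) (e : ℝ → 𝔸) (x : ℝ) : 𝔸 :=
  (Complex.I * ρ * Complex.exp (Complex.I * ρ * x)) • (1 : 𝔸) -
    ∫ t in Ioi x, Complex.cos (ρ * (t - x)) • (q t * e t)

namespace IsJost

variable {e : ℝ → 𝔸}

theorem norm_jostDeriv_sub_le (he : IsJost q ρ e) (hq : IntegrableOn q (Ioi 0)) (hρ : ρ ≠ 0)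
    (him : 0 ≤ ρ.im) (hK : 2 * ∫ t in Ioi 0, ‖q t‖ ≤ ‖ρ‖) {x : ℝ} (hx : 0 ≤ x) :
    ‖jostDeriv q ρ e x - (Complex.I * ρ * Complex.exp (Complex.I * ρ * x)) • (1 : 𝔸)‖ ≤
      (∫ t in Ioi 0, ‖q t‖) * (2 * ‖(1 : 𝔸)‖) * Real.exp (-(ρ.im * x)) := by
  rw [jostDeriv, sub_sub_cancel_left, norm_neg]
  refine (norm_integral_Ioi_smul_le hq hx zero_le_one (s := ρ.im) (fun t ht => ?_)
    (fun t ht => he.norm_le hq hρ him hK (hx.trans ht))).trans_eq (by ring)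
  have := norm_cos_le_exp _ (abs_im_mul_ofReal him (sub_nonneg.2 ht))
  simpa using this

theorem norm_jostDeriv_le (he : IsJost q ρ e) (hq : IntegrableOn q (Ioi 0)) (hρ : ρ ≠ 0)
    (him : 0 ≤ ρ.im) (hK : 2 * ∫ t in Ioi 0, ‖q t‖ ≤ ‖ρ‖) {x : ℝ} (hx : 0 ≤ x) :
    ‖jostDeriv q ρ e x‖ ≤ 2 * ‖(1 : 𝔸)‖ * ‖ρ‖ * Real.exp (-(ρ.im * x)) := by
  have h1 := he.norm_jostDeriv_sub_le hq hρ him hK hx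
  have h2 : ‖(Complex.I * ρ * Complex.exp (Complex.I * ρ * x)) • (1 : 𝔸)‖ =
      ‖ρ‖ * Real.exp (-(ρ.im * x)) * ‖(1 : 𝔸)‖ := by
    rw [norm_smul, norm_mul, norm_mul, Complex.norm_I, one_mul, norm_exp_I_mul]
  have h3 := norm_add_le (jostDeriv q ρ e x -
    (Complex.I * ρ * Complex.exp (Complex.I * ρ * x)) • (1 : 𝔸))
    ((Complex.I * ρ * Complex.exp (Complex.I * ρ * x)) • (1 : 𝔸))
  rw [sub_add_cancel, h2] at h3
  have h4 : (∫ t in Ioi 0, ‖q t‖) * (2 * ‖(1 : 𝔸)‖) * Real.exp (-(ρ.im * x)) ≤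
      ‖ρ‖ / 2 * (2 * ‖(1 : 𝔸)‖) * Real.exp (-(ρ.im * x)) := by
    gcongr; linarith
  linarith

/-- The addition formulas separate `x` from `t` in the kernels. Then `e` and `jostDeriv` are
combinations of elementary functions of `x` and tail integrals, to which the product rule applies.
-/
theorem isSol (he : IsJost q ρ e) (hq : IntegrableOn q (Ioi 0)) (hρ : ρ ≠ 0) (him : 0 ≤ ρ.im)
    {X : ℝ} (hX : 0 ≤ X) : IsSol q (ρ ^ 2) X e (jostDeriv q ρ e) := by
  have iS : IntegrableOn (fun t : ℝ => Complex.sin (ρ * t) • (q t * e t)) (Ioi 0) :=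
    he.integrableOn_smul hq (by fun_prop) fun t ht => norm_sin_le_exp _ (abs_im_mul_ofReal him ht)
  have iC : IntegrableOn (fun t : ℝ => Complex.cos (ρ * t) • (q t * e t)) (Ioi 0) :=
    he.integrableOn_smul hq (by fun_prop) fun t ht => norm_cos_le_exp _ (abs_im_mul_ofReal him ht)
  set S := fun x : ℝ => ∫ t in Ioi x, Complex.sin (ρ * t) • (q t * e t) with hS
  set C := fun x : ℝ => ∫ t in Ioi x, Complex.cos (ρ * t) • (q t * e t) with hC
  have pS : IsPrimitive S (fun x => -(Complex.sin (ρ * x) • (q x * e x))) X :=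
    isPrimitive_integral_Ioi iS hX
  have pC : IsPrimitive C (fun x => -(Complex.cos (ρ * x) • (q x * e x))) X :=
    isPrimitive_integral_Ioi iC hX
  have hlin : ∀ x : ℝ, HasDerivAt (fun x : ℝ => ρ * (x : ℂ)) ρ x := fun x => by
    simpa using (Complex.ofRealCLM.hasDerivAt (x := x)).const_mul ρ
  have hlinI : ∀ x : ℝ, HasDerivAt (fun x : ℝ => Complex.I * ρ * (x : ℂ)) (Complex.I * ρ) x :=
    fun x => by simpa using (Complex.ofRealCLM.hasDerivAt (x := x)).const_mul (Complex.I * ρ)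
  have dcos : ∀ x : ℝ, HasDerivAt (fun x : ℝ => Complex.cos (ρ * x))
      (-Complex.sin (ρ * x) * ρ) x := fun x => (Complex.hasDerivAt_cos _).comp x (hlin x)
  have dsin : ∀ x : ℝ, HasDerivAt (fun x : ℝ => Complex.sin (ρ * x))
      (Complex.cos (ρ * x) * ρ) x := fun x => (Complex.hasDerivAt_sin _).comp x (hlin x)
  have dexp : ∀ x : ℝ, HasDerivAt (fun x : ℝ => Complex.exp (Complex.I * ρ * x))
      (Complex.exp (Complex.I * ρ * x) * (Complex.I * ρ)) x := fun x =>
    (Complex.hasDerivAt_exp _).comp x (hlinI x)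
  have pcos := IsPrimitive.of_hasDerivAt (X := X) dcos (by fun_prop)
  have psin := IsPrimitive.of_hasDerivAt (X := X) dsin (by fun_prop)
  have pexp := IsPrimitive.of_hasDerivAt (X := X) dexp (by fun_prop)
  have hr : ρ * ρ⁻¹ = 1 := mul_inv_cancel₀ hρ
  have hI : Complex.I * Complex.I = -1 := Complex.I_mul_I
  have hE : ∀ x, 0 ≤ x → e x = Complex.exp (Complex.I * ρ * x) • (1 : 𝔸) +
      ((Complex.cos (ρ * x) * ρ⁻¹) • S x - (Complex.sin (ρ * x) * ρ⁻¹) • C x) := by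
    intro x hx
    have iS' := (iS.mono_set (Ioi_subset_Ioi hx)).smul (Complex.cos (ρ * x) * ρ⁻¹)
    have iC' := (iC.mono_set (Ioi_subset_Ioi hx)).smul (Complex.sin (ρ * x) * ρ⁻¹)
    rw [he.integral_eq x hx, hS, hC, ← integral_smul, ← integral_smul]
    congr 1
    refine Eq.trans ?_ (integral_sub iS' iC')
    congr 1
    ext t
    simp only [smul_smul, ← sub_smul]
    congr 1
    rw [mul_sub, Complex.sin_sub]
    ring
  have hE' : ∀ x, 0 ≤ x → jostDeriv q ρ e x =
      (Complex.I * ρ * Complex.exp (Complex.I * ρ * x)) • (1 : 𝔸) -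
      (Complex.cos (ρ * x) • C x + Complex.sin (ρ * x) • S x) := by
    intro x hx
    have iS' := (iS.mono_set (Ioi_subset_Ioi hx)).smul (Complex.sin (ρ * x))
    have iC' := (iC.mono_set (Ioi_subset_Ioi hx)).smul (Complex.cos (ρ * x))
    rw [jostDeriv, hS, hC, ← integral_smul, ← integral_smul]
    congr 1
    refine Eq.trans ?_ (integral_add iC' iS')
    congr 1
    ext t
    simp only [smul_smul, ← add_smul]
    congr 1
    rw [mul_sub, Complex.cos_sub]
    ring
  have L : ∀ {c c' : ℝ → ℂ} {u v : ℝ → 𝔸}, IsPrimitive c c' X → IsPrimitive u v X →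
      IsPrimitive (fun x => c x • u x) (fun x => c' x • u x + c x • v x) X := fun hc hu =>
    hc.bilin hu (ContinuousLinearMap.lsmul ℝ ℂ) hX
  have M : ∀ {c c' : ℝ → ℂ} (a : ℂ), IsPrimitive c c' X →
      IsPrimitive (fun x => c x * a) (fun x => c' x * a) X := fun a hc =>
    hc.clm ((ContinuousLinearMap.mul ℝ ℂ).flip a)
  have p1 : IsPrimitive (fun _ => (1 : 𝔸)) (fun _ => 0) X :=
    IsPrimitive.of_hasDerivAt (fun x => hasDerivAt_const x _) continuous_const
  refine ⟨?_, ?_⟩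
  · refine ((L pexp p1).add ((L (M ρ⁻¹ pcos) pS).sub (L (M ρ⁻¹ psin) pC))).congr hX
      (fun x hx => hE x hx.1) (fun x hx => ?_)
    dsimp only
    rw [hE' x hx.1.le]
    linear_combination (norm := module) (Complex.sin (ρ * x) * hr) • S x + (Complex.cos (ρ * x) * hr) • C x
  · refine ((L (M (Complex.I * ρ) pexp) p1).sub ((L pcos pC).add (L psin pS))).congr hX
      (fun x hx => (hE' x hx.1).trans ?_) (fun x hx => ?_)
    · simp only [mul_comm (Complex.I * ρ)]
    dsimp only
    have h := hE x hx.1.le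
    generalize q x * e x = g at *
    rw [h]
    linear_combination (norm := module) (-(ρ ^ 2) * Complex.exp (Complex.I * ρ * x) * hI) • (1 : 𝔸) +
      (-ρ * Complex.cos (ρ * x) * hr) • S x + (ρ * Complex.sin (ρ * x) * hr) • C x -
      (Complex.sin_sq_add_cos_sq (ρ * x)) • g

end IsJost

end Jost

/-! ### Boundary form, asymptotics of the Weyl solution and of the Weyl matrix -/

section Weyl

variable {𝔸 : Type*} [NormedRing 𝔸] [NormedAlgebra ℂ 𝔸] [CompleteSpace 𝔸]

/-- The coefficients of a problem with values in a Banach algebra. -/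
structure IsProb (q : ℝ → 𝔸) (A h : 𝔸) : Prop where
  integrable : IntegrableOn q (Ioi 0)
  idem : A * A = A
  compressed : h = A * h * A

/-- The boundary form on the initial values `y₀ = Y(0)` and `y₁ = Y'(0)`. -/
def form (A h y₀ y₁ : 𝔸) : 𝔸 := A * (y₁ - h * y₀) - (1 - A) * y₀

/-- The boundary form rescaled to have a limit on Jost solutions as `ρ → ∞`. -/
noncomputable def scaledForm (A h : 𝔸) (ρ : ℂ) (y₀ y₁ : 𝔸) : 𝔸 :=
  A * (ρ⁻¹ • (y₁ - h * y₀)) - (1 - A) * y₀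

theorem IsProb.mul_compressed {q : ℝ → 𝔸} {A h : 𝔸} (hL : IsProb q A h) : A * h = h := by
  rw [hL.compressed, ← mul_assoc, ← mul_assoc, hL.idem]

theorem IsProb.compressed_mul {q : ℝ → 𝔸} {A h : 𝔸} (hL : IsProb q A h) : h * A = h := by
  rw [hL.compressed, mul_assoc, hL.idem]

theorem scale_mul_scale {A : 𝔸} (hA : A * A = A) {a b : ℂ} (hab : a * b = 1) :
    (a • A + (1 - A)) * (b • A + (1 - A)) = 1 := by
  simp only [mul_add, add_mul, mul_sub, sub_mul, hA, mul_one, one_mul, mul_smul_comm,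
    smul_mul_assoc]
  rw [sub_self, add_zero, smul_smul, mul_comm b a, hab, one_smul]
  abel

/-- Isolates the unbounded part of the boundary form in an explicit factor with inverse `ρ⁻¹ A + (1
- A)`; the other factor converges on Jost solutions. -/
theorem form_eq_scale_mul {A : 𝔸} (hA : A * A = A) (h y₀ y₁ : 𝔸) {ρ : ℂ} (hρ : ρ ≠ 0) :
    form A h y₀ y₁ = (ρ • A + (1 - A)) * scaledForm A h ρ y₀ y₁ := by
  have h1 : A * (A * (y₁ - h * y₀)) = A * (y₁ - h * y₀) := by rw [← mul_assoc, hA]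
  have h2 : A * ((1 - A) * y₀) = 0 := by rw [← mul_assoc, mul_sub, hA, mul_one, sub_self, zero_mul]
  rw [form, scaledForm]
  generalize y₁ - h * y₀ = w at *
  generalize (1 - A) * y₀ = z at *
  simp only [add_mul, mul_sub, sub_mul, one_mul, smul_mul_assoc, mul_smul_comm, h1, h2]
  rw [sub_self, add_zero, smul_smul, inv_mul_cancel₀ hρ, one_smul]
  simp

theorem isUnit_form {A : 𝔸} (hA : A * A = A) {h y₀ y₁ : 𝔸} {ρ : ℂ} (hρ : ρ ≠ 0)
    (hu : IsUnit (scaledForm A h ρ y₀ y₁)) : IsUnit (form A h y₀ y₁) := by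
  rw [form_eq_scale_mul hA h y₀ y₁ hρ]
  exact IsUnit.mul ⟨⟨_, _, scale_mul_scale hA (mul_inv_cancel₀ hρ),
    scale_mul_scale hA (inv_mul_cancel₀ hρ)⟩, rfl⟩ hu

theorem inverse_form {A : 𝔸} (hA : A * A = A) {h y₀ y₁ : 𝔸} {ρ : ℂ} (hρ : ρ ≠ 0)
    (hu : IsUnit (scaledForm A h ρ y₀ y₁)) :
    Ring.inverse (form A h y₀ y₁) =
      Ring.inverse (scaledForm A h ρ y₀ y₁) * (ρ⁻¹ • A + (1 - A)) := by
  rw [form_eq_scale_mul hA h y₀ y₁ hρ, Ring.inverse_mul (Or.inr hu)]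
  congr 1
  exact Ring.inverse_unit ⟨_, _, scale_mul_scale hA (mul_inv_cancel₀ hρ),
    scale_mul_scale hA (inv_mul_cancel₀ hρ)⟩

/-- Multiplication of the boundary condition by `A` and by `1 - A` gives `A y₁ - h y₀ = A` and `(1 -
A) y₀ = -(1 - A)`. The two components still missing are those collected in the Weyl matrix. -/
theorem IsProb.initial_eq {q : ℝ → 𝔸} {A h : 𝔸} (hL : IsProb q A h) {y₀ y₁ : 𝔸}
    (hy : form A h y₀ y₁ = 1) :
    y₀ = A * (A * y₀ + (1 - A) * y₁) - (1 - A) ∧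
      y₁ = A + (h + (1 - A)) * (A * y₀ + (1 - A) * y₁) := by
  have hA := hL.idem
  have hA' : ∀ z, A * (A * z) = A * z := fun z => by rw [← mul_assoc, hA]
  have hAh : ∀ z, A * (h * z) = h * z := fun z => by rw [← mul_assoc, hL.mul_compressed]
  have hhA : ∀ z, h * (A * z) = h * z := fun z => by rw [← mul_assoc, hL.compressed_mul]
  have e1 : A * y₁ - h * y₀ = A := by
    have := congrArg (A * ·) hy
    simp only [form, mul_sub, sub_mul, hA', hAh, one_mul, mul_one] at this
    refine Eq.trans ?_ this
    abel
  have e2 : y₀ - A * y₀ = -(1 - A) := by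
    have := congrArg ((1 - A) * ·) hy
    simp only [form, mul_sub, sub_mul, hA', hAh, one_mul, mul_one] at this
    refine Eq.trans ?_ (congrArg Neg.neg this)
    abel
  constructor
  · simp only [mul_add, mul_sub, sub_mul, one_mul, hA', sub_self, add_zero]
    rw [sub_eq_iff_eq_add] at e2
    rw [e2]
    simp only [mul_add, mul_neg, mul_sub, mul_one, hA, hA']
    abel
  · simp only [add_mul, mul_add, mul_sub, sub_mul, one_mul, hA', hhA]
    have e3 : y₁ = (A * y₁ - h * y₀) + (h * y₀ + (y₁ - A * y₁)) := by abel
    rw [e1] at e3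
    refine e3.trans ?_
    abel

theorem scaledForm_limit_mul {A : 𝔸} (hA : A * A = A) {a b : ℂ} (hab : a * b = 1) :
    (a • A - (1 - A)) * (b • A - (1 - A)) = 1 := by
  simp only [mul_sub, sub_mul, hA, mul_one, one_mul, mul_smul_comm,
    smul_mul_assoc]
  rw [sub_self, sub_zero, smul_smul, mul_comm b a, hab, one_smul]
  abel

/-- The directions in which `ρ → ∞` in `Omega`. -/
noncomputable def atInfty : Filter ℂ := Bornology.cobounded ℂ ⊓ 𝓟 Omega

theorem eventually_atInfty {p : ℂ → Prop} :
    (∀ᶠ ρ in atInfty, p ρ) ↔ ∃ R : ℝ, ∀ ρ ∈ Omega, R ≤ ‖ρ‖ → p ρ := by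
  rw [atInfty, (hasBasis_cobounded_norm.inf_principal Omega).eventually_iff]
  simp only [true_and, mem_inter_iff, mem_ofPred_eq]
  exact exists_congr fun R => ⟨fun h ρ h1 h2 => h ⟨h2, h1⟩, fun h ρ hρ => h ρ hρ.2 hρ.1⟩

theorem tendsto_inv_atInfty : Tendsto (fun ρ : ℂ => ρ⁻¹) atInfty (𝓝 0) :=
  tendsto_inv₀_cobounded.mono_left inf_le_left

variable {q : ℝ → 𝔸} {A h : 𝔸} {e : ℂ → ℝ → 𝔸}

/-- A choice of Jost solutions for all large `ρ`. -/
def IsJostFamily (q : ℝ → 𝔸) (e : ℂ → ℝ → 𝔸) : Prop :=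
  ∀ ρ ∈ Omega, 2 * (∫ t in Ioi 0, ‖q t‖) ≤ ‖ρ‖ → IsJost q ρ (e ρ)

theorem exists_isJostFamily (hq : IntegrableOn q (Ioi 0)) : ∃ e, IsJostFamily q e := by
  have : ∀ ρ : ℂ, ∃ e, ρ ∈ Omega → 2 * (∫ t in Ioi 0, ‖q t‖) ≤ ‖ρ‖ → IsJost q ρ e := by
    intro ρ
    by_cases hρ : ρ ∈ Omega ∧ 2 * (∫ t in Ioi 0, ‖q t‖) ≤ ‖ρ‖
    · obtain ⟨e, he⟩ := exists_isJost hq hρ.1.2 hρ.1.1 hρ.2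
      exact ⟨e, fun _ _ => he⟩
    · exact ⟨0, fun h1 h2 => absurd ⟨h1, h2⟩ hρ⟩
  choose e he using this
  exact ⟨e, he⟩

theorem eventually_large (q : ℝ → 𝔸) : ∀ᶠ ρ in atInfty,
    ρ ∈ Omega ∧ 2 * (∫ t in Ioi 0, ‖q t‖) ≤ ‖ρ‖ ∧ 1 ≤ ‖ρ‖ :=
  eventually_atInfty.2 ⟨max (2 * (∫ t in Ioi 0, ‖q t‖)) 1, fun _ hρ h =>
    ⟨hρ, (le_max_left _ _).trans h, (le_max_right _ _).trans h⟩⟩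

theorem norm_exp_neg_I_mul (ρ : ℂ) (x : ℝ) :
    ‖Complex.exp (-(Complex.I * ρ * x))‖ = Real.exp (ρ.im * x) := by
  rw [Complex.norm_exp]; simp [mul_assoc]

theorem tendsto_norm_inv_mul (c : ℝ) : Tendsto (fun ρ : ℂ => ‖ρ‖⁻¹ * c) atInfty (𝓝 0) := by
  have := (tendsto_inv_atInfty.norm).mul_const c
  simpa using this

namespace IsJostFamily

theorem tendsto_exp_smul (he : IsJostFamily q e) (hq : IntegrableOn q (Ioi 0)) {x : ℝ}
    (hx : 0 ≤ x) :
    Tendsto (fun ρ : ℂ => Complex.exp (-(Complex.I * ρ * x)) • e ρ x) atInfty (𝓝 1) := by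
  rw [tendsto_iff_norm_sub_tendsto_zero]
  refine squeeze_zero' (Eventually.of_forall fun _ => norm_nonneg _) ?_
    (tendsto_norm_inv_mul ((∫ t in Ioi 0, ‖q t‖) * (2 * ‖(1 : 𝔸)‖)))
  filter_upwards [eventually_large q] with ρ ⟨hΩ, hK, _⟩
  have h1 := (he ρ hΩ hK).norm_sub_le hq hΩ.2 hΩ.1 hK hx
  have h2 : Complex.exp (-(Complex.I * ρ * x)) • e ρ x - 1 =
      Complex.exp (-(Complex.I * ρ * x)) • (e ρ x - Complex.exp (Complex.I * ρ * x) • (1 : 𝔸)) := by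
    rw [smul_sub, smul_smul, ← Complex.exp_add]; simp
  rw [h2, norm_smul, norm_exp_neg_I_mul]
  calc _ ≤ Real.exp (ρ.im * x) * (‖ρ‖⁻¹ * (∫ t in Ioi 0, ‖q t‖) * (2 * ‖(1 : 𝔸)‖) *
        Real.exp (-(ρ.im * x))) := by gcongr
    _ = ‖ρ‖⁻¹ * ((∫ t in Ioi 0, ‖q t‖) * (2 * ‖(1 : 𝔸)‖)) *
        (Real.exp (ρ.im * x) * Real.exp (-(ρ.im * x))) := by ring
    _ = _ := by rw [← Real.exp_add]; simp

theorem tendsto_zero (he : IsJostFamily q e) (hq : IntegrableOn q (Ioi 0)) :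
    Tendsto (fun ρ : ℂ => e ρ 0) atInfty (𝓝 1) := by
  simpa using he.tendsto_exp_smul hq le_rfl

theorem tendsto_deriv_zero (he : IsJostFamily q e) (hq : IntegrableOn q (Ioi 0)) :
    Tendsto (fun ρ : ℂ => ρ⁻¹ • jostDeriv q ρ (e ρ) 0) atInfty (𝓝 (Complex.I • 1)) := by
  rw [tendsto_iff_norm_sub_tendsto_zero]
  refine squeeze_zero' (Eventually.of_forall fun _ => norm_nonneg _) ?_
    (tendsto_norm_inv_mul ((∫ t in Ioi 0, ‖q t‖) * (2 * ‖(1 : 𝔸)‖)))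
  filter_upwards [eventually_large q] with ρ ⟨hΩ, hK, _⟩
  have h1 := (he ρ hΩ hK).norm_jostDeriv_sub_le hq hΩ.2 hΩ.1 hK le_rfl
  simp only [Complex.ofReal_zero, mul_zero, Complex.exp_zero, mul_one, neg_zero,
    Real.exp_zero] at h1
  have h2 : ρ⁻¹ • jostDeriv q ρ (e ρ) 0 - Complex.I • (1 : 𝔸) =
      ρ⁻¹ • (jostDeriv q ρ (e ρ) 0 - (Complex.I * ρ) • (1 : 𝔸)) := by
    rw [smul_sub, smul_smul, mul_left_comm, inv_mul_cancel₀ hΩ.2, mul_one]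
  rw [h2, norm_smul, norm_inv]
  gcongr

theorem tendsto_scaledForm (he : IsJostFamily q e) (hq : IntegrableOn q (Ioi 0)) :
    Tendsto (fun ρ : ℂ => scaledForm A h ρ (e ρ 0) (jostDeriv q ρ (e ρ) 0)) atInfty
      (𝓝 (Complex.I • A - (1 - A))) := by
  have t0 := he.tendsto_zero hq
  have t1 := he.tendsto_deriv_zero hq
  have t2 := (t1.sub (tendsto_inv_atInfty.smul (t0.const_mul h))).const_mul A
  have t3 := t2.sub (t0.const_mul (1 - A))
  simp only [scaledForm, smul_sub]
  convert! t3 using 2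
  simp

theorem eventually_isUnit (he : IsJostFamily q e) (hL : IsProb q A h) :
    ∀ᶠ ρ in atInfty, IsUnit (scaledForm A h ρ (e ρ 0) (jostDeriv q ρ (e ρ) 0)) := by
  have hu : IsUnit (Complex.I • A - (1 - A)) :=
    ⟨⟨_, _, scaledForm_limit_mul hL.idem (b := -Complex.I) (by simp),
      scaledForm_limit_mul hL.idem (by simp)⟩, rfl⟩
  exact (he.tendsto_scaledForm hL.integrable).eventually (Units.isOpen.mem_nhds hu)

theorem tendsto_inverse (he : IsJostFamily q e) (hL : IsProb q A h) :
    Tendsto (fun ρ : ℂ => Ring.inverse (scaledForm A h ρ (e ρ 0) (jostDeriv q ρ (e ρ) 0)))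
      atInfty (𝓝 (-Complex.I • A - (1 - A))) := by
  have := (NormedRing.inverse_continuousAt (⟨_, _, scaledForm_limit_mul hL.idem
    (a := Complex.I) (b := -Complex.I) (by simp),
      scaledForm_limit_mul hL.idem (by simp)⟩ : 𝔸ˣ)).tendsto.comp
        (he.tendsto_scaledForm hL.integrable (A := A) (h := h))
  rwa [Ring.inverse_unit] at this

/-- The leading behaviour of the Weyl matrix as `ρ → ∞`. -/
theorem tendsto_weyl (he : IsJostFamily q e) (hL : IsProb q A h) :
    Tendsto (fun ρ : ℂ => 1 - (-(Complex.I * ρ))⁻¹ •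
      (A * (e ρ 0 * Ring.inverse (form A h (e ρ 0) (jostDeriv q ρ (e ρ) 0))) +
        (1 - A) * (jostDeriv q ρ (e ρ) 0 *
          Ring.inverse (form A h (e ρ 0) (jostDeriv q ρ (e ρ) 0))))) atInfty (𝓝 A) := by
  have hA := hL.idem
  have t0 := he.tendsto_zero hL.integrable
  have t1 := he.tendsto_deriv_zero hL.integrable
  have tN := he.tendsto_inverse hL
  have tD : Tendsto (fun ρ : ℂ => ρ⁻¹ • A + (1 - A)) atInfty (𝓝 (1 - A)) := by
    simpa using (tendsto_inv_atInfty.smul_const A).add_const (1 - A)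
  have t := ((((tendsto_inv_atInfty.smul (t0.const_mul A)).add (t1.const_mul (1 - A))).mul
    (tN.mul tD)).const_smul Complex.I).const_sub 1
  -- The `A`-row of the Weyl matrix is lost after division by `ρ`, and the scaling factor tends to
  -- `1 - A`; only the block `(1 - A) i (-(1 - A))` survives.
  have hlim : 1 - Complex.I • (((0 : ℂ) • (A * 1) + (1 - A) * (Complex.I • 1)) *
      ((-Complex.I • A - (1 - A)) * (1 - A))) = A := by
    have hc : A * (1 - A) = 0 := by rw [mul_sub, mul_one, hA, sub_self]
    have hcc : (1 - A) * (1 - A) = 1 - A := by rw [sub_mul, one_mul, hc, sub_zero]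
    rw [sub_mul (-Complex.I • A), smul_mul_assoc, hc, hcc, zero_smul, smul_zero, zero_add, zero_sub,
      mul_smul_comm, mul_one, smul_mul_assoc, mul_neg, hcc, smul_neg, smul_neg, smul_smul,
      Complex.I_mul_I]
    simp
  rw [hlim] at t
  refine t.congr' ?_
  filter_upwards [eventually_large q, he.eventually_isUnit hL] with ρ ⟨hΩ, _, _⟩ hu
  rw [inverse_form hA hΩ.2 hu]
  have hi : (-(Complex.I * ρ))⁻¹ = Complex.I * ρ⁻¹ := by
    rw [← neg_mul, mul_inv, inv_neg, Complex.inv_I, neg_neg]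
  rw [hi, ← smul_smul]
  congr 2
  simp only [add_mul, smul_add, mul_assoc, smul_mul_assoc, mul_smul_comm]

/-- The constants are uniform in `x`: the inverse of the scaled form is bounded near infinity
because it converges, and the Jost bounds hold on the whole half-line. -/
theorem exists_bound (he : IsJostFamily q e) (hL : IsProb q A h) : ∃ c R : ℝ, 0 ≤ c ∧
    ∀ ρ ∈ Omega, R ≤ ‖ρ‖ → 1 ≤ ‖ρ‖ ∧ 2 * (∫ t in Ioi 0, ‖q t‖) ≤ ‖ρ‖ ∧
      IsUnit (scaledForm A h ρ (e ρ 0) (jostDeriv q ρ (e ρ) 0)) ∧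
      ∀ x : ℝ, 0 ≤ x →
        ‖e ρ x * Ring.inverse (scaledForm A h ρ (e ρ 0) (jostDeriv q ρ (e ρ) 0))‖ ≤
          c * Real.exp (-(ρ.im * x)) ∧
        ‖jostDeriv q ρ (e ρ) x *
          Ring.inverse (scaledForm A h ρ (e ρ 0) (jostDeriv q ρ (e ρ) 0))‖ ≤
          c * ‖ρ‖ * Real.exp (-(ρ.im * x)) := by
  set b := ‖-Complex.I • A - (1 - A)‖ + 1 with hb
  have hev := (he.tendsto_inverse hL).norm.eventually (gt_mem_nhds (lt_add_one _))
  obtain ⟨R, hR⟩ := eventually_atInfty.1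
    ((eventually_large q).and ((he.eventually_isUnit hL).and hev))
  refine ⟨2 * ‖(1 : 𝔸)‖ * b, R, by positivity, fun ρ hΩ hρ => ?_⟩
  obtain ⟨⟨_, hK, h1⟩, hu, hlt⟩ := hR ρ hΩ hρ
  have hJ := he ρ hΩ hK
  refine ⟨h1, hK, hu, fun x hx => ⟨?_, ?_⟩⟩
  · refine (norm_mul_le _ _).trans ?_
    calc _ ≤ (2 * ‖(1 : 𝔸)‖ * Real.exp (-(ρ.im * x))) * b := by
          gcongr
          exact hJ.norm_le hL.integrable hΩ.2 hΩ.1 hK hx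
      _ = _ := by ring
  · refine (norm_mul_le _ _).trans ?_
    calc _ ≤ (2 * ‖(1 : 𝔸)‖ * ‖ρ‖ * Real.exp (-(ρ.im * x))) * b := by
          gcongr
          exact hJ.norm_jostDeriv_le hL.integrable hΩ.2 hΩ.1 hK hx
      _ = _ := by ring

end IsJostFamily

end Weyl

/-! ### The transposed problem, Wronskians of Weyl solutions, Liouville's theorem -/

section Uniqueness

open MulOpposite (op unop)

variable {𝔸 : Type*} [NormedRing 𝔸] [NormedAlgebra ℂ 𝔸] [CompleteSpace 𝔸]
  {q q' : ℝ → 𝔸} {A h h' : 𝔸} {ρ : ℂ}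

theorem IsProb.op (hL : IsProb q A h) :
    IsProb (fun t => op (q t)) (op A) (op h) where
  integrable := ((MulOpposite.opContinuousLinearEquiv ℝ : 𝔸 ≃L[ℝ] 𝔸ᵐᵒᵖ).toContinuousLinearMap
    ).integrable_comp hL.integrable
  idem := congrArg MulOpposite.op hL.idem
  compressed := by
    rw [← MulOpposite.op_mul, ← MulOpposite.op_mul, ← mul_assoc, ← hL.compressed]

theorem form_mul (A h y₀ y₁ a : 𝔸) : form A h (y₀ * a) (y₁ * a) = form A h y₀ y₁ * a := by
  simp only [form, sub_mul, mul_sub, mul_assoc]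

/-- The Wronskian is constant in `x` and bounded by a multiple of `exp(-2 x Im ρ)`, which tends to
zero as `Im ρ > 0`. -/
theorem IsJost.wronskian_eq_zero {e : ℝ → 𝔸} {eo : ℝ → 𝔸ᵐᵒᵖ} (he : IsJost q ρ e)
    (heo : IsJost (fun t => MulOpposite.op (q t)) ρ eo) (hL : IsProb q A h) (him : 0 < ρ.im)
    (hK : 2 * ∫ t in Ioi 0, ‖q t‖ ≤ ‖ρ‖) :
    (jostDeriv (fun t => MulOpposite.op (q t)) ρ eo 0).unop * e 0 -
      (eo 0).unop * jostDeriv q ρ e 0 = 0 := by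
  have hρ : ρ ≠ 0 := fun h0 => by simp [h0] at him
  set c := 2 * ((2 * ‖(1 : 𝔸)‖ * ‖ρ‖) * (2 * ‖(1 : 𝔸)‖)) with hc
  have hb : ∀ x : ℝ, 0 ≤ x → ‖(jostDeriv (fun t => MulOpposite.op (q t)) ρ eo 0).unop * e 0 -
      (eo 0).unop * jostDeriv q ρ e 0‖ ≤ c * Real.exp (-(2 * ρ.im * x)) := by
    intro x hx
    rw [← (he.isSol hL.integrable hρ him.le hx).wronskian
      (heo.isSol hL.op.integrable hρ him.le hx) ⟨hx, le_rfl⟩]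
    have b1 := he.norm_le hL.integrable hρ him.le hK hx
    have b2 := he.norm_jostDeriv_le hL.integrable hρ him.le hK hx
    have b3 : ‖(eo x).unop‖ ≤ 2 * ‖(1 : 𝔸)‖ * Real.exp (-(ρ.im * x)) :=
      heo.norm_le hL.op.integrable hρ him.le hK hx
    have b4 : ‖(jostDeriv (fun t => MulOpposite.op (q t)) ρ eo x).unop‖ ≤
        2 * ‖(1 : 𝔸)‖ * ‖ρ‖ * Real.exp (-(ρ.im * x)) :=
      heo.norm_jostDeriv_le hL.op.integrable hρ him.le hK hx
    refine (_root_.norm_sub_le _ _).trans ((add_le_add (norm_mul_le _ _) (norm_mul_le _ _)).trans ?_)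
    calc _ ≤ (2 * ‖(1 : 𝔸)‖ * ‖ρ‖ * Real.exp (-(ρ.im * x))) *
          (2 * ‖(1 : 𝔸)‖ * Real.exp (-(ρ.im * x))) +
          (2 * ‖(1 : 𝔸)‖ * Real.exp (-(ρ.im * x))) *
          (2 * ‖(1 : 𝔸)‖ * ‖ρ‖ * Real.exp (-(ρ.im * x))) := by gcongr
      _ = c * (Real.exp (-(ρ.im * x)) * Real.exp (-(ρ.im * x))) := by rw [hc]; ring
      _ = _ := by rw [← Real.exp_add]; ring_nf
  have ht : Tendsto (fun x : ℝ => c * Real.exp (-(2 * ρ.im * x))) atTop (𝓝 0) := by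
    have h1 : Tendsto (fun x : ℝ => 2 * ρ.im * x) atTop atTop :=
      tendsto_id.const_mul_atTop (by positivity)
    simpa using (Real.tendsto_exp_neg_atTop_nhds_zero.comp h1).const_mul c
  exact norm_le_zero_iff.1 (ge_of_tendsto ht ((eventually_ge_atTop 0).mono hb))

/-- `Y` is the Weyl solution at `ρ`, with the derivative `Z` and the Weyl matrix `M`. -/
structure IsWeyl (q : ℝ → 𝔸) (A h : 𝔸) (ρ : ℂ) (Y Z : ℝ → 𝔸) (M : 𝔸) : Prop where
  sol : ∀ X, 0 ≤ X → IsSol q (ρ ^ 2) X Y Z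
  initial : Y 0 = A * M - (1 - A)
  initial' : Z 0 = A + (h + (1 - A)) * M

theorem IsJost.isWeyl {e : ℝ → 𝔸} (he : IsJost q ρ e) (hL : IsProb q A h) (hρ : ρ ∈ Omega)
    (hu : IsUnit (form A h (e 0) (jostDeriv q ρ e 0))) :
    IsWeyl q A h ρ (fun x => e x * Ring.inverse (form A h (e 0) (jostDeriv q ρ e 0)))
      (fun x => jostDeriv q ρ e x * Ring.inverse (form A h (e 0) (jostDeriv q ρ e 0)))
      (A * (e 0 * Ring.inverse (form A h (e 0) (jostDeriv q ρ e 0))) +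
        (1 - A) * (jostDeriv q ρ e 0 * Ring.inverse (form A h (e 0) (jostDeriv q ρ e 0)))) := by
  have hf := hL.initial_eq (y₀ := e 0 * Ring.inverse (form A h (e 0) (jostDeriv q ρ e 0)))
    (y₁ := jostDeriv q ρ e 0 * Ring.inverse (form A h (e 0) (jostDeriv q ρ e 0)))
    (by rw [form_mul, Ring.mul_inverse_cancel _ hu])
  exact ⟨fun X hX => (he.isSol hL.integrable hρ.2 hρ.1 hX).mul_const _, hf.1, hf.2⟩

/-- Turns the vanishing of the Wronskian of two Weyl solutions into equality of their Weyl matrices,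
and conversely. -/
theorem wronskian_weyl_initial (hL : IsProb q A h) (M N : 𝔸) :
    (A + N * (h + (1 - A))) * (A * M - (1 - A)) - (N * A - (1 - A)) * (A + (h + (1 - A)) * M) =
      M - N := by
  have hA := hL.idem
  have hA' : ∀ z, A * (A * z) = A * z := fun z => by rw [← mul_assoc, hA]
  have hAh : ∀ z, A * (h * z) = h * z := fun z => by rw [← mul_assoc, hL.mul_compressed]
  have hhA : ∀ z, h * (A * z) = h * z := fun z => by rw [← mul_assoc, hL.compressed_mul]
  simp only [mul_add, add_mul, mul_sub, sub_mul, mul_one, one_mul, mul_assoc, hA, hA', hAh, hhA,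
    hL.compressed_mul]
  abel

namespace IsWeyl

variable {Y Z : ℝ → 𝔸} {M : 𝔸} {Yo Zo : ℝ → 𝔸ᵐᵒᵖ} {N : 𝔸}

theorem wronskian (hW : IsWeyl q A h ρ Y Z M) (hL : IsProb q A h)
    (hWo : IsWeyl (fun t => op (q t)) (op A) (op h) ρ Yo Zo (op N)) {x : ℝ} (hx : 0 ≤ x) :
    (Zo x).unop * Y x - (Yo x).unop * Z x = M - N := by
  rw [(hW.sol x hx).wronskian (hWo.sol x hx) ⟨hx, le_rfl⟩, hW.initial, hW.initial',
    hWo.initial, hWo.initial']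
  exact wronskian_weyl_initial hL M N

/-- Normalisation of the regular transposed solution against the Weyl solution; together with
`wronskian` it inverts the fundamental matrix. -/
theorem wronskian_regular (hW : IsWeyl q A h ρ Y Z M) (hL : IsProb q A h) {x : ℝ} (hx : 0 ≤ x)
    (hS : IsSol (fun t => op (q t)) (ρ ^ 2) x Yo Zo) (h0 : Yo 0 = op A)
    (h1 : Zo 0 = op ((1 - A) + h)) :
    (Zo x).unop * Y x - (Yo x).unop * Z x = -1 := by
  have hA := hL.idem
  have hA' : ∀ z, A * (A * z) = A * z := fun z => by rw [← mul_assoc, hA]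
  have hAh : ∀ z, A * (h * z) = h * z := fun z => by rw [← mul_assoc, hL.mul_compressed]
  have hhA : ∀ z, h * (A * z) = h * z := fun z => by rw [← mul_assoc, hL.compressed_mul]
  rw [(hW.sol x hx).wronskian hS ⟨hx, le_rfl⟩, hW.initial, hW.initial', h0, h1]
  simp only [MulOpposite.unop_op, mul_add, add_mul, mul_sub, sub_mul, mul_one, one_mul, hA,
    hA', hAh, hhA, hL.compressed_mul]
  abel

theorem eq_add_mul (hW : IsWeyl q A h ρ Y Z M) (hL : IsProb q A h) (hρ : ρ ∈ Omega)
    (hK : 2 * ∫ t in Ioi 0, ‖q t‖ ≤ ‖ρ‖) {S S' C C' : ℝ → 𝔸} {X : ℝ} (hX : 0 ≤ X)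
    (hS : IsSol q (ρ ^ 2) X S S') (hS0 : S 0 = A) (hS1 : S' 0 = (1 - A) + h)
    (hC : IsSol q (ρ ^ 2) X C C') (hC0 : C 0 = -(1 - A)) (hC1 : C' 0 = A) :
    Y X = C X + S X * M ∧ Z X = C' X + S' X * M := by
  refine (hW.sol X hX).eqOn_of_initial hL.integrable hρ.2 hρ.1 hK (hC.add (hS.mul_const M)) ?_ ?_
    ⟨hX, le_rfl⟩
  · rw [hW.initial, hC0, hS0]; abel
  · rw [hW.initial', hC1, hS1, add_comm h]

end IsWeyl

/-- The Weyl matrices of a problem and of its transpose agree. -/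
theorem IsJost.weyl_op_eq {e : ℝ → 𝔸} {eo : ℝ → 𝔸ᵐᵒᵖ} (he : IsJost q ρ e)
    (heo : IsJost (fun t => MulOpposite.op (q t)) ρ eo) (hL : IsProb q A h) (him : 0 < ρ.im)
    (hK : 2 * ∫ t in Ioi 0, ‖q t‖ ≤ ‖ρ‖) {a M N : 𝔸} {b : 𝔸ᵐᵒᵖ}
    (hW : IsWeyl q A h ρ (fun x => e x * a) (fun x => jostDeriv q ρ e x * a) M)
    (hWo : IsWeyl (fun t => op (q t)) (op A) (op h) ρ (fun x => eo x * b)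
      (fun x => jostDeriv (fun t => op (q t)) ρ eo x * b) (op N)) : M = N := by
  have h1 := hW.wronskian hL hWo le_rfl
  have h2 := congrArg (fun z => b.unop * z * a) (he.wronskian_eq_zero heo hL him hK)
  simp only [MulOpposite.unop_mul] at h1
  rw [← sub_eq_zero, ← h1]
  simpa only [mul_sub, sub_mul, mul_assoc, mul_zero, zero_mul] using h2

/-- Right multiplication by `ρ⁻¹ A + (1 - A)` turns the initial values into `ρ⁻¹ A` and `(1 - A) +
ρ⁻¹ h`. Both then contribute order `1 / ρ` to the general growth bound, which would not hold for `S`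
itself. -/
theorem norm_regular_mul_scale_le (hL : IsProb q A h) (hρ : ρ ∈ Omega)
    (hK : 2 * ∫ t in Ioi 0, ‖q t‖ ≤ ‖ρ‖) (h1ρ : 1 ≤ ‖ρ‖) {S S' : ℝ → 𝔸} {X : ℝ} (hX : 0 ≤ X)
    (hS : IsSol q (ρ ^ 2) X S S') (hS0 : S 0 = A) (hS1 : S' 0 = (1 - A) + h) :
    ‖S X * (ρ⁻¹ • A + (1 - A))‖ ≤
        2 * (‖A‖ + ‖1 - A‖ + ‖h‖) * ‖ρ‖⁻¹ * Real.exp (ρ.im * X) ∧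
      ‖S' X * (ρ⁻¹ • A + (1 - A))‖ ≤ 2 * (‖A‖ + ‖1 - A‖ + ‖h‖) * Real.exp (ρ.im * X) := by
  have hρ0 : 0 < ‖ρ‖ := norm_pos_iff.2 hρ.2
  have hA := hL.idem
  have hT := hS.mul_const (ρ⁻¹ • A + (1 - A))
  have i0 : S 0 * (ρ⁻¹ • A + (1 - A)) = ρ⁻¹ • A := by
    rw [hS0]
    simp only [mul_add, mul_sub, mul_one, mul_smul_comm, hA, sub_self, add_zero]
  have i1 : S' 0 * (ρ⁻¹ • A + (1 - A)) = (1 - A) + ρ⁻¹ • h := by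
    rw [hS1]
    simp only [mul_add, mul_sub, mul_one, mul_smul_comm, add_mul, sub_mul, one_mul, hA,
      hL.compressed_mul, sub_self, zero_add]
    abel
  have hb : ‖ρ⁻¹ • A‖ + ‖(1 - A) + ρ⁻¹ • h‖ / ‖ρ‖ ≤ (‖A‖ + ‖1 - A‖ + ‖h‖) * ‖ρ‖⁻¹ := by
    have e1 : ‖(1 - A) + ρ⁻¹ • h‖ ≤ ‖1 - A‖ + ‖h‖ := by
      refine (norm_add_le _ _).trans (add_le_add le_rfl ?_)
      rw [norm_smul, norm_inv]
      exact mul_le_of_le_one_left (norm_nonneg _) (inv_le_one_of_one_le₀ h1ρ)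
    rw [norm_smul, norm_inv, div_eq_mul_inv]
    calc _ ≤ ‖ρ‖⁻¹ * ‖A‖ + (‖1 - A‖ + ‖h‖) * ‖ρ‖⁻¹ := by gcongr
      _ = _ := by ring
  have b0 := hT.norm_le hL.integrable hρ.2 hρ.1 hK ⟨hX, le_rfl⟩
  have b1 := hT.norm_deriv_le hL.integrable hρ.2 hρ.1 hK ⟨hX, le_rfl⟩
  simp only [i0, i1] at b0 b1
  refine ⟨b0.trans ?_, b1.trans ?_⟩
  · calc _ ≤ 2 * ((‖A‖ + ‖1 - A‖ + ‖h‖) * ‖ρ‖⁻¹) * Real.exp (ρ.im * X) := by gcongr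
      _ = _ := by ring
  · calc _ ≤ 2 * ‖ρ‖ * ((‖A‖ + ‖1 - A‖ + ‖h‖) * ‖ρ‖⁻¹) * Real.exp (ρ.im * X) := by gcongr
      _ = _ := by field_simp

theorem exists_sq_eq_of_im_ne_zero {μ : ℂ} (hμ : μ.im ≠ 0) : ∃ ρ : ℂ, 0 < ρ.im ∧ ρ ^ 2 = μ := by
  obtain ⟨z, hz⟩ := IsAlgClosed.exists_pow_nat_eq μ zero_lt_two
  have hzi : z.im ≠ 0 := fun h0 => hμ (by rw [← hz]; simp [sq, Complex.mul_im, h0])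
  rcases hzi.lt_or_gt with h | h
  · exact ⟨-z, by simpa using h, by rw [neg_sq, hz]⟩
  · exact ⟨z, h, hz⟩

/-- Liouville's theorem for entire functions bounded near infinity off the real axis. -/
theorem eq_of_bounded_off_real {f : ℂ → 𝔸} (hf : Differentiable ℂ f) {c R : ℝ}
    (hb : ∀ μ : ℂ, μ.im ≠ 0 → R < ‖μ‖ → ‖f μ‖ ≤ c) (z w : ℂ) : f z = f w := by
  refine hf.apply_eq_apply_of_bounded ?_ z w
  have hd : Dense {μ : ℂ | μ.im ≠ 0} := by
    have := (dense_compl_singleton (0 : ℝ)).preimage Complex.isOpenMap_im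
    exact this
  have ho : IsOpen {μ : ℂ | R < ‖μ‖} := isOpen_lt continuous_const continuous_norm
  have hout : ∀ μ : ℂ, R < ‖μ‖ → ‖f μ‖ ≤ c := by
    intro μ hμ
    have hcl : closure ({μ : ℂ | R < ‖μ‖} ∩ {μ : ℂ | μ.im ≠ 0}) ⊆ {μ | ‖f μ‖ ≤ c} :=
      closure_minimal (fun ν hν => hb ν hν.2 hν.1)
        (isClosed_le hf.continuous.norm continuous_const)
    exact hcl (hd.open_subset_closure_inter ho hμ)
  have hin := (isCompact_closedBall (0 : ℂ) R).image hf.continuous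
  refine (hin.isBounded.union (Metric.isBounded_closedBall (x := (0 : 𝔸)) (r := c))).subset ?_
  rintro _ ⟨μ, rfl⟩
  rcases le_or_gt ‖μ‖ R with h | h
  · exact Or.inl ⟨μ, by simpa using h, rfl⟩
  · exact Or.inr (by simpa using hout μ h)

theorem tendsto_I_mul_atInfty : Tendsto (fun τ : ℝ => Complex.I * τ) atTop atInfty := by
  refine tendsto_inf.2 ⟨?_, ?_⟩
  · rw [← tendsto_norm_atTop_iff_cobounded]
    simpa using tendsto_abs_atTop_atTop
  · rw [tendsto_principal]
    filter_upwards [eventually_gt_atTop 0] with τ hτ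
    exact ⟨by simpa using hτ.le, by simp [hτ.ne']⟩

end Uniqueness

/-! ### The spectral mapping -/

section Uniqueness

open MulOpposite (op unop)

variable {𝔸 : Type*} [NormedRing 𝔸] [NormedAlgebra ℂ 𝔸] [CompleteSpace 𝔸]
  {q q' : ℝ → 𝔸} {A h h' : 𝔸}

/-- The Weyl solution built from the Jost solution `e ρ`. -/
noncomputable def weylFamily (q : ℝ → 𝔸) (A h : 𝔸) (e : ℂ → ℝ → 𝔸) (ρ : ℂ) (x : ℝ) : 𝔸 :=
  e ρ x * Ring.inverse (form A h (e ρ 0) (jostDeriv q ρ (e ρ) 0))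

/-- The derivative of the Weyl solution. -/
noncomputable def weylFamilyDeriv (q : ℝ → 𝔸) (A h : 𝔸) (e : ℂ → ℝ → 𝔸) (ρ : ℂ) (x : ℝ) : 𝔸 :=
  jostDeriv q ρ (e ρ) x * Ring.inverse (form A h (e ρ 0) (jostDeriv q ρ (e ρ) 0))

/-- The Weyl matrix as a function of `ρ`. -/
noncomputable def weylM (q : ℝ → 𝔸) (A h : 𝔸) (e : ℂ → ℝ → 𝔸) (ρ : ℂ) : 𝔸 :=
  A * weylFamily q A h e ρ 0 + (1 - A) * weylFamilyDeriv q A h e ρ 0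

/-- Everything that is used about the Weyl solutions for large `ρ`. -/
theorem IsJostFamily.exists_weyl {e : ℂ → ℝ → 𝔸} (he : IsJostFamily q e) (hL : IsProb q A h) :
    ∃ c R : ℝ, 0 ≤ c ∧ ∀ ρ ∈ Omega, R ≤ ‖ρ‖ →
      1 ≤ ‖ρ‖ ∧ 2 * (∫ t in Ioi 0, ‖q t‖) ≤ ‖ρ‖ ∧
      IsWeyl q A h ρ (weylFamily q A h e ρ) (weylFamilyDeriv q A h e ρ) (weylM q A h e ρ) ∧
      ∀ x : ℝ, 0 ≤ x → ∃ F F' : 𝔸,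
        weylFamily q A h e ρ x = F * (ρ⁻¹ • A + (1 - A)) ∧
        weylFamilyDeriv q A h e ρ x = F' * (ρ⁻¹ • A + (1 - A)) ∧
        ‖F‖ ≤ c * Real.exp (-(ρ.im * x)) ∧ ‖F'‖ ≤ c * ‖ρ‖ * Real.exp (-(ρ.im * x)) := by
  obtain ⟨c, R, hc, hR⟩ := he.exists_bound hL
  refine ⟨c, R, hc, fun ρ hΩ hρ => ?_⟩
  obtain ⟨h1, hK, hu, hb⟩ := hR ρ hΩ hρ
  refine ⟨h1, hK, (he ρ hΩ hK).isWeyl hL hΩ (isUnit_form hL.idem hΩ.2 hu), fun x hx =>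
    ⟨_, _, ?_, ?_, (hb x hx).1, (hb x hx).2⟩⟩
  · rw [weylFamily, inverse_form hL.idem hΩ.2 hu, mul_assoc]
  · rw [weylFamilyDeriv, inverse_form hL.idem hΩ.2 hu, mul_assoc]

/-- The limit depends on `A` alone and is invertible, so it can be compared between two problems
with the same projection. -/
theorem tendsto_weylFamily {e : ℂ → ℝ → 𝔸} (he : IsJostFamily q e) (hL : IsProb q A h) {x : ℝ}
    (hx : 0 ≤ x) :
    Tendsto (fun ρ : ℂ => Complex.exp (-(Complex.I * ρ * x)) •
      (weylFamily q A h e ρ x * (ρ • A + (1 - A)))) atInfty (𝓝 (-Complex.I • A - (1 - A))) := by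
  have t := (he.tendsto_exp_smul hL.integrable hx).mul (he.tendsto_inverse hL)
  rw [one_mul] at t
  refine t.congr' ?_
  filter_upwards [eventually_large q, he.eventually_isUnit hL] with ρ ⟨hΩ, _, _⟩ hu
  rw [weylFamily, inverse_form hL.idem hΩ.2 hu, mul_assoc (e ρ x), mul_assoc (Ring.inverse _),
    scale_mul_scale hL.idem (inv_mul_cancel₀ hΩ.2), mul_one, smul_mul_assoc]

theorem unop_scale (ρ : ℂ) (A : 𝔸) : (ρ⁻¹ • op A + (1 - op A)).unop = ρ⁻¹ • A + (1 - A) := rfl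

/-- At a fixed point, the spectral mapping between two problems with the same Weyl matrix is the
identity. -/
theorem weylFamily_eq {e e' : ℂ → ℝ → 𝔸} (he : IsJostFamily q e) (he' : IsJostFamily q' e')
    (hL : IsProb q A h) (hL' : IsProb q' A h')
    (hM : ∀ᶠ ρ in atInfty, weylM q A h e ρ = weylM q' A h' e' ρ) :
    ∃ R : ℝ, ∀ ρ ∈ Omega, 0 < ρ.im → R ≤ ‖ρ‖ → ∀ X, 0 ≤ X →
      weylFamily q A h e ρ X = weylFamily q' A h' e' ρ X := by
  obtain ⟨eo, heo⟩ := exists_isJostFamily hL'.op.integrable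
  obtain ⟨RM, hRM⟩ := eventually_atInfty.1 hM
  obtain ⟨c, R₁, hc, hw⟩ := he.exists_weyl hL
  obtain ⟨c', R₂, hc', hw'⟩ := he'.exists_weyl hL'
  obtain ⟨co, R₃, hco, hwo⟩ := heo.exists_weyl hL'.op
  set R := max (max RM R₁) (max R₂ R₃) with hR
  refine ⟨R, ?_⟩
  set k := 2 * (‖A‖ + ‖1 - A‖ + ‖h‖) with hk
  set ko := 2 * (‖op A‖ + ‖1 - op A‖ + ‖op h'‖) with hko
  -- `P₁` and `P₂` form the first row of the fundamental matrix of the first problem times the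
  -- inverse of that of the second. The threshold `R` does not depend on `X`, so that a single `ρ`
  -- will later serve all points.
  have key : ∀ X, 0 ≤ X → ∃ P₁ P₂ : ℂ → 𝔸, Differentiable ℂ P₁ ∧ Differentiable ℂ P₂ ∧
      ∀ ρ ∈ Omega, 0 < ρ.im → R ≤ ‖ρ‖ → ‖P₁ (ρ ^ 2)‖ ≤ k * co + c * ko ∧
        ‖P₂ (ρ ^ 2)‖ ≤ (c * ko + k * co) * ‖ρ‖⁻¹ ∧
        weylFamily q A h e ρ X = P₁ (ρ ^ 2) * weylFamily q' A h' e' ρ X +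
          P₂ (ρ ^ 2) * weylFamilyDeriv q' A h' e' ρ X := by
    intro X hX
    obtain ⟨S, S₁, hS, dS, dS₁⟩ := exists_entire_isSol hL.integrable hX A ((1 - A) + h)
    obtain ⟨C, C₁, hC, dC, dC₁⟩ := exists_entire_isSol hL.integrable hX (-(1 - A)) A
    obtain ⟨So, So₁, hSo, dSo, dSo₁⟩ :=
      exists_entire_isSol hL'.op.integrable hX (op A) (op ((1 - A) + h'))
    obtain ⟨Co, Co₁, hCo, dCo, dCo₁⟩ :=
      exists_entire_isSol hL'.op.integrable hX (op (-(1 - A))) (op A)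
    have du : ∀ {f : ℂ → 𝔸ᵐᵒᵖ}, Differentiable ℂ f → Differentiable ℂ (fun μ => (f μ).unop) :=
      fun hf => ((MulOpposite.opContinuousLinearEquiv ℂ).symm :
        𝔸ᵐᵒᵖ ≃L[ℂ] 𝔸).differentiable.comp hf
    refine ⟨fun μ => S μ X * (Co₁ μ X).unop - C μ X * (So₁ μ X).unop,
      fun μ => C μ X * (So μ X).unop - S μ X * (Co μ X).unop,
      (dS.mul (du dCo₁)).sub (dC.mul (du dSo₁)), (dC.mul (du dSo)).sub (dS.mul (du dCo)), ?_⟩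
    intro ρ hΩ him hρ
    obtain ⟨h1, hK, hW, hF⟩ := hw ρ hΩ (((le_max_right _ _).trans (le_max_left _ _)).trans hρ)
    obtain ⟨-, hK', hW', -⟩ := hw' ρ hΩ (((le_max_left _ _).trans (le_max_right _ _)).trans hρ)
    obtain ⟨-, hKo, hWo, hFo⟩ := hwo ρ hΩ (((le_max_right _ _).trans (le_max_right _ _)).trans hρ)
    have hρ0 : ‖ρ‖ ≠ 0 := norm_ne_zero_iff.2 hΩ.2
    have hMM := hRM ρ hΩ (((le_max_left _ _).trans (le_max_left _ _)).trans hρ)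
    set M := weylM q A h e ρ with hMdef
    have hMo : weylM q' A h' e' ρ = (weylM (fun t => op (q' t)) (op A) (op h') eo ρ).unop :=
      (he' ρ hΩ hK').weyl_op_eq (heo ρ hΩ hKo) hL' him hK' hW' hWo
    have hMo' : weylM (fun t => op (q' t)) (op A) (op h') eo ρ = op M := by
      rw [hMM, hMo, MulOpposite.op_unop]
    rw [← hMM] at hW'
    rw [hMo'] at hWo
    have eY := (hW.eq_add_mul hL hΩ hK hX (hS _).1 (hS _).2.1 (hS _).2.2 (hC _).1 (hC _).2.1
      (hC _).2.2)
    have eYo := (hWo.eq_add_mul hL'.op hΩ hKo hX (hSo _).1 (hSo _).2.1 (hSo _).2.2 (hCo _).1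
      (hCo _).2.1 (hCo _).2.2)
    set Y := weylFamily q A h e ρ X
    set Yo := weylFamily (fun t => op (q' t)) (op A) (op h') eo ρ X
    set Zo := weylFamilyDeriv (fun t => op (q' t)) (op A) (op h') eo ρ X
    have uYo : (Co (ρ ^ 2) X).unop = Yo.unop - M * (So (ρ ^ 2) X).unop := by
      rw [eYo.1]; simp
    have uZo : (Co₁ (ρ ^ 2) X).unop = Zo.unop - M * (So₁ (ρ ^ 2) X).unop := by
      rw [eYo.2]; simp
    have uY : C (ρ ^ 2) X = Y - S (ρ ^ 2) X * M := by rw [eY.1]; simp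
    -- The decisive cancellation: the terms `S M So₁` agree only because both problems, and the
    -- transposed one, share the matrix `M`. Each product now pairs a growing factor with a decaying
    -- one.
    have p1 : S (ρ ^ 2) X * (Co₁ (ρ ^ 2) X).unop - C (ρ ^ 2) X * (So₁ (ρ ^ 2) X).unop =
        S (ρ ^ 2) X * Zo.unop - Y * (So₁ (ρ ^ 2) X).unop := by
      rw [uZo, uY]; noncomm_ring
    have p2 : C (ρ ^ 2) X * (So (ρ ^ 2) X).unop - S (ρ ^ 2) X * (Co (ρ ^ 2) X).unop =
        Y * (So (ρ ^ 2) X).unop - S (ρ ^ 2) X * Yo.unop := by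
      rw [uYo, uY]; noncomm_ring
    dsimp only
    rw [p1, p2]
    obtain ⟨F, -, hYF, -, bF, -⟩ := hF X hX
    replace hYF : Y = F * (ρ⁻¹ • A + (1 - A)) := hYF
    obtain ⟨Fo, Fo', hYo, hZo, bFo, bFo'⟩ := hFo X hX
    have bS := (norm_regular_mul_scale_le hL hΩ hK h1 hX (hS _).1 (hS _).2.1 (hS _).2.2).1
    have bSo := norm_regular_mul_scale_le hL'.op hΩ hKo h1 hX (hSo _).1 (hSo _).2.1 (hSo _).2.2
    rw [← hk] at bS
    rw [← hko] at bSo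
    have bSo0 : ‖(ρ⁻¹ • A + (1 - A)) * (So (ρ ^ 2) X).unop‖ ≤
        ko * ‖ρ‖⁻¹ * Real.exp (ρ.im * X) := bSo.1
    have bSo1 : ‖(ρ⁻¹ • A + (1 - A)) * (So₁ (ρ ^ 2) X).unop‖ ≤
        ko * Real.exp (ρ.im * X) := bSo.2
    have uFo : Yo.unop = (ρ⁻¹ • A + (1 - A)) * Fo.unop := by
      rw [← unop_scale, ← MulOpposite.unop_mul, ← hYo]
    have uFo' : Zo.unop = (ρ⁻¹ • A + (1 - A)) * Fo'.unop := by
      rw [← unop_scale, ← MulOpposite.unop_mul, ← hZo]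
    have bFo0 : ‖Fo.unop‖ ≤ co * Real.exp (-(ρ.im * X)) := bFo
    have bFo1 : ‖Fo'.unop‖ ≤ co * ‖ρ‖ * Real.exp (-(ρ.im * X)) := bFo'
    have hee : Real.exp (ρ.im * X) * Real.exp (-(ρ.im * X)) = 1 := by
      rw [← Real.exp_add]; simp
    have hkp : 0 ≤ k := by positivity
    have hkop : 0 ≤ ko := by positivity
    refine ⟨?_, ?_, ?_⟩
    -- The factor `ρ⁻¹ A + (1 - A)` of a Weyl solution is reassociated to the neighbouring regular
    -- solution, where it gains the missing power of `ρ`.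
    · rw [uFo', hYF, ← mul_assoc, mul_assoc F]
      refine (norm_sub_le _ _).trans ((add_le_add (norm_mul_le _ _) (norm_mul_le _ _)).trans ?_)
      calc _ ≤ (k * ‖ρ‖⁻¹ * Real.exp (ρ.im * X)) * (co * ‖ρ‖ * Real.exp (-(ρ.im * X))) +
            (c * Real.exp (-(ρ.im * X))) * (ko * Real.exp (ρ.im * X)) := by gcongr
        _ = (k * co * (‖ρ‖⁻¹ * ‖ρ‖) + c * ko) *
            (Real.exp (ρ.im * X) * Real.exp (-(ρ.im * X))) := by ring
        _ = _ := by rw [hee, inv_mul_cancel₀ hρ0, mul_one, mul_one]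
    · rw [uFo, hYF, ← mul_assoc (S (ρ ^ 2) X), mul_assoc F]
      refine (norm_sub_le _ _).trans ((add_le_add (norm_mul_le _ _) (norm_mul_le _ _)).trans ?_)
      calc _ ≤ (c * Real.exp (-(ρ.im * X))) * (ko * ‖ρ‖⁻¹ * Real.exp (ρ.im * X)) +
            (k * ‖ρ‖⁻¹ * Real.exp (ρ.im * X)) * (co * Real.exp (-(ρ.im * X))) := by gcongr
        _ = (c * ko + k * co) * ‖ρ‖⁻¹ *
            (Real.exp (ρ.im * X) * Real.exp (-(ρ.im * X))) := by ring
        _ = _ := by rw [hee, mul_one]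
    · have w1 := hW'.wronskian hL' hWo hX
      have w2 := hW'.wronskian_regular hL' hX (hSo _).1 (hSo _).2.1 (hSo _).2.2
      rw [sub_self] at w1
      -- The first bracket is the Wronskian of two Weyl solutions, equal to `0`; the second is the
      -- normalised one, equal to `-1`.
      calc Y = S (ρ ^ 2) X * (Zo.unop * weylFamily q' A h' e' ρ X -
            Yo.unop * weylFamilyDeriv q' A h' e' ρ X) -
          Y * ((So₁ (ρ ^ 2) X).unop * weylFamily q' A h' e' ρ X -
            (So (ρ ^ 2) X).unop * weylFamilyDeriv q' A h' e' ρ X) := by rw [w1, w2]; simp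
        _ = _ := by noncomm_ring
  intro ρ hΩ him hρ X hX
  obtain ⟨P₁, P₂, d₁, d₂, hP⟩ := key X hX
  -- The square reflects `|μ| = |ρ|²`; the maximum with `1` lets `|ρ|⁻¹` be bounded by `1`.
  have hlarge : ∀ μ : ℂ, μ.im ≠ 0 → (max R 1) ^ 2 < ‖μ‖ →
      ∃ ρ ∈ Omega, 0 < ρ.im ∧ R ≤ ‖ρ‖ ∧ 1 ≤ ‖ρ‖ ∧ ρ ^ 2 = μ := by
    intro μ hμ hlt
    obtain ⟨ρ, hi, rfl⟩ := exists_sq_eq_of_im_ne_zero hμ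
    rw [norm_pow] at hlt
    have hle := (lt_of_pow_lt_pow_left₀ 2 (norm_nonneg _) hlt).le
    exact ⟨ρ, ⟨hi.le, fun h0 => by simp [h0] at hi⟩, hi, (le_max_left _ _).trans hle,
      (le_max_right _ _).trans hle, rfl⟩
  have hB : 0 ≤ c * ko + k * co := by positivity
  have const₁ := eq_of_bounded_off_real d₁ (c := k * co + c * ko) (R := (max R 1) ^ 2)
    fun μ hμ hlt => by
      obtain ⟨ρ, hΩ, hi, hρ, _, rfl⟩ := hlarge μ hμ hlt
      exact (hP ρ hΩ hi hρ).1
  have const₂ := eq_of_bounded_off_real d₂ (c := c * ko + k * co) (R := (max R 1) ^ 2)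
    fun μ hμ hlt => by
      obtain ⟨ρ, hΩ, hi, hρ, h1, rfl⟩ := hlarge μ hμ hlt
      exact (hP ρ hΩ hi hρ).2.1.trans (mul_le_of_le_one_right hB (inv_le_one_of_one_le₀ h1))
  have hev : ∀ᶠ τ : ℝ in atTop, Complex.I * τ ∈ Omega ∧ 0 < (Complex.I * τ).im ∧
      R ≤ ‖Complex.I * (τ : ℂ)‖ := by
    filter_upwards [eventually_gt_atTop 0, eventually_ge_atTop R] with τ hτ hτR
    exact ⟨⟨by simpa using hτ.le, by simp [hτ.ne']⟩, by simpa using hτ,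
      by simpa using hτR.trans (le_abs_self τ)⟩
  have hP₂ : ∀ μ, P₂ μ = 0 := by
    intro μ
    have ht := ((tendsto_norm_inv_mul (c * ko + k * co)).comp tendsto_I_mul_atInfty)
    refine norm_le_zero_iff.1 (ge_of_tendsto ht ?_)
    filter_upwards [hev] with τ ⟨h1, h2, h3⟩
    rw [const₂ μ ((Complex.I * τ) ^ 2)]
    exact ((hP _ h1 h2 h3).2.1).trans_eq (mul_comm _ _)
  -- After rescaling along `ρ = iτ`, both Weyl solutions tend to `U = -iA - (1 - A)`. Hence `U = P₁
  -- U`, and `U` is cancelled by its inverse `iA - (1 - A)`.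
  have hP₁ : P₁ 0 = 1 := by
    have t := (tendsto_weylFamily he hL hX).comp tendsto_I_mul_atInfty
    have t' := ((tendsto_weylFamily he' hL' hX).comp tendsto_I_mul_atInfty).const_mul (P₁ 0)
    have hU := scaledForm_limit_mul hL.idem (a := -Complex.I) (b := Complex.I) (by simp)
    have heq : -Complex.I • A - (1 - A) = P₁ 0 * (-Complex.I • A - (1 - A)) := by
      refine tendsto_nhds_unique t (t'.congr' ?_)
      filter_upwards [hev] with τ ⟨h1, h2, h3⟩
      have e := (hP _ h1 h2 h3).2.2
      rw [hP₂, zero_mul, add_zero, const₁ _ 0] at e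
      rw [Function.comp_apply, Function.comp_apply, e, mul_smul_comm,
        mul_assoc (P₁ 0)]
    have := congrArg (· * (Complex.I • A - (1 - A))) heq
    simp only [mul_assoc, hU, mul_one] at this
    exact this.symm
  rw [(hP ρ hΩ him hρ).2.2, hP₂, const₁ _ 0, hP₁, one_mul, zero_mul, add_zero]

end Uniqueness

/-! ### Recovery of the coefficients from the Weyl solution -/

theorem IsPrimitive.ae_eq {E : Type*} [NormedAddCommGroup E] [NormedSpace ℝ E] [CompleteSpace E]
    {u u' v v' : ℝ → E} {X : ℝ} (h : IsPrimitive u v X) (h' : IsPrimitive u' v' X) (hX : 0 ≤ X)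
    (huu : EqOn u u' (Icc 0 X)) : ∀ᵐ x, x ∈ Ioo 0 X → v x = v' x := by
  filter_upwards [h.ae_hasDerivAt hX, h'.ae_hasDerivAt hX] with x hx hx' hm
  refine (hx hm).unique ((hx' hm).congr_of_eventuallyEq ?_)
  filter_upwards [Ioo_mem_nhds hm.1 hm.2] with y hy
  exact huu (Ioo_subset_Icc_self hy)

section Coefficients

variable {𝔸 : Type*} [NormedRing 𝔸] [NormedAlgebra ℂ 𝔸] [CompleteSpace 𝔸]
  {q q' : ℝ → 𝔸} {A h h' : 𝔸} {μ : ℂ} {Y Z Y' Z' : ℝ → 𝔸}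

theorem IsSol.deriv_eqOn {X : ℝ} (hX : 0 < X) (hS : IsSol q μ X Y Z) (hS' : IsSol q' μ X Y' Z')
    (hY : EqOn Y Y' (Icc 0 X)) : EqOn Z Z' (Icc 0 X) := by
  refine Measure.eqOn_Icc_of_ae_eq (μ := volume) hX.ne ?_ hS.prim'.continuousOn
    hS'.prim'.continuousOn
  rw [EventuallyEq, ae_restrict_congr_set Ioo_ae_eq_Icc.symm, ae_restrict_iff' measurableSet_Ioo]
  exact hS.prim.ae_eq hS'.prim hX.le hY

/-- Equal solutions have equal derivatives, and differentiating once more gives `q Y = q' Y` almost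
everywhere; `Y` is then cancelled. -/
theorem ae_eq_coefficient (hS : ∀ X, 0 ≤ X → IsSol q μ X Y Z)
    (hS' : ∀ X, 0 ≤ X → IsSol q' μ X Y' Z') (hY : ∀ X, 0 ≤ X → Y X = Y' X)
    (hu : ∀ X, 0 ≤ X → IsUnit (Y X)) : q =ᵐ[volume.restrict (Ioi 0)] q' := by
  rw [EventuallyEq, ae_restrict_iff' measurableSet_Ioi]
  have hN : ∀ᵐ x, ∀ N : ℕ, x ∈ Ioo (0 : ℝ) (N + 1) →
      q x * Y x - μ • Y x = q' x * Y' x - μ • Y' x := by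
    refine ae_all_iff.2 fun N => ?_
    have hN0 : (0 : ℝ) < N + 1 := by positivity
    exact (hS _ hN0.le).prim'.ae_eq (hS' _ hN0.le).prim' hN0.le
      ((hS _ hN0.le).deriv_eqOn hN0 (hS' _ hN0.le) fun x hx => hY x hx.1)
  filter_upwards [hN] with x hx hx0
  obtain ⟨N, hN⟩ := exists_nat_gt x
  have e := hx N ⟨hx0, by linarith⟩
  have hx0' : 0 ≤ x := le_of_lt hx0
  rw [← hY x hx0'] at e
  exact (hu x hx0').mul_right_cancel (sub_left_injective e)

/-- Equality of `Z 0` and `Z' 0` gives `h M = h' M`. Since `h A = h` and `h (1 - A) = 0`, the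
product `h (Y 0)` equals `h M`, and likewise for `h'`; the unit `Y 0` is then cancelled. -/
theorem IsWeyl.eq_boundary {ρ : ℂ} {M : 𝔸} (hW : IsWeyl q A h ρ Y Z M)
    (hW' : IsWeyl q' A h' ρ Y' Z' M) (hL : IsProb q A h) (hL' : IsProb q' A h')
    (hY : ∀ X, 0 ≤ X → Y X = Y' X) (hu : IsUnit (Y 0)) : h = h' := by
  have hZ : Z 0 = Z' 0 := (hW.sol 1 zero_le_one).deriv_eqOn one_pos (hW'.sol 1 zero_le_one)
    (fun x hx => hY x hx.1) ⟨le_rfl, zero_le_one⟩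
  rw [hW.initial', hW'.initial', add_right_inj, add_mul, add_mul, add_left_inj] at hZ
  refine hu.mul_right_cancel ?_
  simp only [hW.initial, mul_sub, mul_one, ← mul_assoc, hL.compressed_mul, hL'.compressed_mul, hZ,
    sub_self]

/-- The distance of `exp(-iρX) e` from `1` is `O(1/ρ)` uniformly in `X`, so one Neumann-series
threshold works for all `X`. -/
theorem IsJostFamily.eventually_isUnit_apply {e : ℂ → ℝ → 𝔸} (he : IsJostFamily q e)
    (hq : IntegrableOn q (Ioi 0)) :
    ∀ᶠ ρ in atInfty, ∀ X, 0 ≤ X → IsUnit (e ρ X) := by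
  filter_upwards [eventually_large q, (tendsto_norm_inv_mul
    ((∫ t in Ioi 0, ‖q t‖) * (2 * ‖(1 : 𝔸)‖))).eventually (gt_mem_nhds one_pos)]
    with ρ ⟨hΩ, hK, _⟩ hlt X hX
  have h1 := (he ρ hΩ hK).norm_sub_le hq hΩ.2 hΩ.1 hK hX
  set z := Complex.exp (Complex.I * ρ * X)
  have hz : z ≠ 0 := Complex.exp_ne_zero _
  have hzn : ‖z‖ = Real.exp (-(ρ.im * X)) := norm_exp_I_mul ρ X
  have hu : IsUnit (1 - (1 - z⁻¹ • e ρ X)) := by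
    refine isUnit_one_sub_of_norm_lt_one (lt_of_le_of_lt ?_ hlt)
    have h2 : 1 - z⁻¹ • e ρ X = -(z⁻¹ • (e ρ X - z • (1 : 𝔸))) := by
      rw [smul_sub, smul_smul, inv_mul_cancel₀ hz, one_smul, neg_sub]
    rw [h2, norm_neg, norm_smul, norm_inv, inv_mul_le_iff₀ (norm_pos_iff.2 hz), hzn]
    exact h1.trans_eq (by ring)
  rw [sub_sub_cancel] at hu
  have h3 : e ρ X = algebraMap ℂ 𝔸 z * (z⁻¹ • e ρ X) := by
    rw [← Algebra.smul_def, smul_smul, mul_inv_cancel₀ hz, one_smul]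
  rw [h3]
  exact ((isUnit_iff_ne_zero.2 hz).map (algebraMap ℂ 𝔸)).mul hu

instance atInfty_neBot : NeBot atInfty := tendsto_I_mul_atInfty.neBot

/-- The Weyl matrix near infinity determines the coefficients, once the projection is known. -/
theorem eq_of_weylM_eq {e e' : ℂ → ℝ → 𝔸} (he : IsJostFamily q e) (he' : IsJostFamily q' e')
    (hL : IsProb q A h) (hL' : IsProb q' A h')
    (hM : ∀ᶠ ρ in atInfty, weylM q A h e ρ = weylM q' A h' e' ρ) :
    q =ᵐ[volume.restrict (Ioi 0)] q' ∧ h = h' := by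
  obtain ⟨R, hR⟩ := weylFamily_eq he he' hL hL' hM
  obtain ⟨c, R₁, -, hw⟩ := he.exists_weyl hL
  obtain ⟨c', R₂, -, hw'⟩ := he'.exists_weyl hL'
  -- A single spectral point `ρ = iτ` suffices: there the Weyl solutions agree and are invertible at
  -- every `X`.
  obtain ⟨τ, hτ, ⟨hΩ, hρ, hρ₁, hρ₂⟩, hm, hu, hs⟩ := ((eventually_gt_atTop (0 : ℝ)).and
    (tendsto_I_mul_atInfty.eventually ((eventually_atInfty.2 ⟨max R (max R₁ R₂), fun ρ h1 h2 =>
      (⟨h1, (le_max_left _ _).trans h2, ((le_max_left _ _).trans (le_max_right _ _)).trans h2,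
        ((le_max_right _ _).trans (le_max_right _ _)).trans h2⟩ :
        ρ ∈ Omega ∧ R ≤ ‖ρ‖ ∧ R₁ ≤ ‖ρ‖ ∧ R₂ ≤ ‖ρ‖)⟩).and
      (hM.and ((he.eventually_isUnit_apply hL.integrable).and (he.eventually_isUnit hL)))))).exists
  have hY := hR _ hΩ (by simpa using hτ) hρ
  obtain ⟨-, -, hW, -⟩ := hw _ hΩ hρ₁
  obtain ⟨-, -, hW', -⟩ := hw' _ hΩ hρ₂
  rw [← hm] at hW'
  have hUY : ∀ X, 0 ≤ X → IsUnit (weylFamily q A h e (Complex.I * τ) X) := fun X hX =>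
    (hu X hX).mul (isUnit_form hL.idem hΩ.2 hs).ringInverse
  exact ⟨ae_eq_coefficient hW.sol hW'.sol hY hUY, hW.eq_boundary hW' hL hL' hY (hUY 0 le_rfl)⟩

end Coefficients

/-! ### Specialisation to matrices -/

section Matrix

variable {n : ℕ} {Q : ℝ → Matrix (Fin n) (Fin n) ℂ} {A h : Matrix (Fin n) (Fin n) ℂ} {ρ : ℂ}

theorem IsProblem.isProb (hL : IsProblem Q A h) : IsProb Q A h :=
  ⟨hL.integrable, hL.projection.isIdempotentElem, hL.compressed⟩

theorem isJostSolution_iff {e : ℝ → Matrix (Fin n) (Fin n) ℂ} :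
    IsJostSolution Q ρ e ↔ IsJost Q ρ e :=
  ⟨fun h => ⟨h.1, h.2, h.3⟩, fun h => ⟨h.1, h.2, h.3⟩⟩

/-- For large `ρ` a Jost solution exists, so the choice made in `jostSolution` is a genuine one. -/
theorem isJostFamily_jostSolution (hQ : IntegrableOn Q (Ioi 0)) :
    IsJostFamily Q (jostSolution Q) := fun _ hρ hK =>
  isJostSolution_iff.1 (Classical.epsilon_spec ((exists_isJost hQ hρ.2 hρ.1 hK).imp
    fun _ => isJostSolution_iff.2))

theorem IsSol.derivAtZero_eq {μ : ℂ} {Y Z : ℝ → Matrix (Fin n) (Fin n) ℂ}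
    (hS : IsSol Q μ 1 Y Z) : derivAtZero Y = Z 0 :=
  (hS.prim.hasDerivWithinAt_zero one_pos hS.prim'.continuousOn).derivWithin
    (uniqueDiffOn_Ici 0 0 self_mem_Ici)

theorem jostMatrix_eq (hL : IsProblem Q A h) (hρ : ρ ∈ Omega)
    (hK : 2 * (∫ t in Ioi 0, ‖Q t‖) ≤ ‖ρ‖) :
    jostMatrix Q A h ρ =
      form A h (jostSolution Q ρ 0) (jostDeriv Q ρ (jostSolution Q ρ) 0) := by
  have hJ := isJostFamily_jostSolution hL.integrable ρ hρ hK
  rw [jostMatrix, boundaryForm, (hJ.isSol hL.integrable hρ.2 hρ.1 zero_le_one).derivAtZero_eq, form]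

theorem weylMatrix_eq (hL : IsProblem Q A h) (hρ : ρ ∈ Omega)
    (hK : 2 * (∫ t in Ioi 0, ‖Q t‖) ≤ ‖ρ‖) :
    weylMatrix Q A h ρ = weylM Q A h (jostSolution Q) ρ := by
  have hJ := isJostFamily_jostSolution hL.integrable ρ hρ hK
  have hS := (hJ.isSol hL.integrable hρ.2 hρ.1 zero_le_one).mul_const (jostMatrix Q A h ρ)⁻¹
  rw [weylMatrix, weylM, weylFamily, weylFamilyDeriv, ← jostMatrix_eq hL hρ hK,
    ← Matrix.nonsing_inv_eq_ringInverse]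
  exact congrArg (fun z => A * weylSolution Q A h ρ 0 + (1 - A) * z) hS.derivAtZero_eq

theorem eventually_mem_weylDomain (hL : IsProblem Q A h) :
    ∀ᶠ ρ in atInfty, ρ ∈ weylDomain Q A h ∧
      weylMatrix Q A h ρ = weylM Q A h (jostSolution Q) ρ := by
  filter_upwards [eventually_large Q,
    (isJostFamily_jostSolution hL.integrable).eventually_isUnit hL.isProb] with ρ ⟨hΩ, hK, _⟩ hu
  refine ⟨⟨hΩ, ?_⟩, weylMatrix_eq hL hΩ hK⟩
  rw [jostMatrix_eq hL hΩ hK, ← isUnit_iff_ne_zero, ← Matrix.isUnit_iff_isUnit_det]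
  exact isUnit_form hL.isProb.idem hΩ.2 hu

theorem tendsto_weylMatrix (hL : IsProblem Q A h) :
    Tendsto (fun ρ : ℂ => 1 - (-(Complex.I * ρ))⁻¹ • weylMatrix Q A h ρ) atInfty (𝓝 A) := by
  refine ((isJostFamily_jostSolution hL.integrable).tendsto_weyl hL.isProb).congr' ?_
  filter_upwards [eventually_mem_weylDomain hL] with ρ hρ
  rw [hρ.2, weylM, weylFamily, weylFamilyDeriv]

theorem eq_of_weylMatrix_eq {Q' : ℝ → Matrix (Fin n) (Fin n) ℂ}
    {A' h' : Matrix (Fin n) (Fin n) ℂ} (hL : IsProblem Q A h) (hL' : IsProblem Q' A' h')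
    (hM : ∀ ρ ∈ weylDomain Q A h ∩ weylDomain Q' A' h',
      weylMatrix Q A h ρ = weylMatrix Q' A' h' ρ) :
    Q =ᵐ[volume.restrict (Ioi 0)] Q' ∧ h = h' ∧ A = A' := by
  have hM' : ∀ᶠ ρ in atInfty, weylMatrix Q A h ρ = weylMatrix Q' A' h' ρ := by
    filter_upwards [eventually_mem_weylDomain hL, eventually_mem_weylDomain hL'] with ρ h1 h2
    exact hM ρ ⟨h1.1, h2.1⟩
  -- The projections are identified first, from the leading term of `M`, because the spectral
  -- mapping requires the same `A` in both problems.
  have hA : A = A' := tendsto_nhds_unique (tendsto_weylMatrix hL)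
    ((tendsto_weylMatrix hL').congr' (hM'.mono fun ρ hρ => by simp only [hρ]))
  subst hA
  have := eq_of_weylM_eq (isJostFamily_jostSolution hL.integrable)
    (isJostFamily_jostSolution hL'.integrable) hL.isProb hL'.isProb (by
      filter_upwards [hM', eventually_mem_weylDomain hL, eventually_mem_weylDomain hL']
        with ρ h0 h1 h2
      rw [← h1.2, ← h2.2, h0])
  exact ⟨this.1, this.2, rfl⟩

end Matrix

end MatrixSchrodinger

theorem theorem1 {n : ℕ}
    (Q Q' : ℝ → Matrix (Fin n) (Fin n) ℂ) (A A' h h' : Matrix (Fin n) (Fin n) ℂ)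
    (hL : MatrixSchrodinger.IsProblem Q A h) (hL' : MatrixSchrodinger.IsProblem Q' A' h') :
    ((∀ ρ ∈ MatrixSchrodinger.weylDomain Q A h ∩ MatrixSchrodinger.weylDomain Q' A' h',
        MatrixSchrodinger.weylMatrix Q A h ρ = MatrixSchrodinger.weylMatrix Q' A' h' ρ) →
      Q =ᵐ[volume.restrict (Ioi 0)] Q' ∧ h = h' ∧ A = A') ∧
    Tendsto
      (fun ρ : ℂ => 1 - (-(Complex.I * ρ))⁻¹ • MatrixSchrodinger.weylMatrix Q A h ρ)
      (Bornology.cobounded ℂ ⊓ 𝓟 MatrixSchrodinger.Omega) (𝓝 A) :=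
  ⟨MatrixSchrodinger.eq_of_weylMatrix_eq hL hL', MatrixSchrodinger.tendsto_weylMatrix hL⟩
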